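/- Let $k$ be a field. For a finite group $\Gamma$, an element $g\in\Gamma$ with centralizer $\Gamma_g$, and a representation $\rho$ of $\Gamma_g$ on $W$, let $M(g,\rho)=k\Gamma\otimes_{k\Gamma_g}W$ be the Yetter--Drinfeld module over $k\Gamma$ with action $h\cdot(x\otimes w)=hx\otimes w$ and coaction $\delta(x\otimes w)=xgx^{-1}\otimes(x\otimes w)$. The category of Yetter--Drinfeld modules over $k\Gamma$ has the braiding $c(m\otimes n)=m_{(-1)}n\otimes m_{(0)}$. For a Yetter--Drinfeld module $V$, $A(V)$ is the tensor algebra of $V$ with the braided Hopf algebra structure in which the elements of $V$ are primitive. A TOBA (Nichols algebra) is a graded Hopf algebra $R=\bigoplus_{n\ge0}R(n)$ in this category with $R(0)\simeq k$, $\bigl(\bigoplus_{i\ge1}R(i)\bigr)^2=\bigoplus_{i\ge2}R(i)$, and $P(R)=R(1)$, where $P(R)=\{x:\Delta(x)=1\otimes x+x\otimes1\}$. Let $D_3=\langle\rho,\sigma\mid\rho^3=\sigma^2=1,\ \sigma\rho=\rho^2\sigma\rangle$, let $\chi$ be the character of the centralizer $\{1,\sigma\}$ of $\sigma$ with $\chi(\sigma)=-1$,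 let $V=M(\sigma,\chi)$, $y_0=1\otimes1$ and $y_i=\rho^i\cdot y_0$ for $i\in\mathbb Z/3$. Let $R^2_3$ be the quotient of $A(V)$ by the ideal generated by $$y_i^2\ (i\in\mathbb Z/3),\qquad y_0y_1+y_1y_2+y_2y_0,\qquad y_0y_2+y_1y_0+y_2y_1.$$ Let $V'$ be the Yetter--Drinfeld module over $kS_3$ with basis $y_\tau$, $\tau$ running over the transpositions, with $\delta(y_\tau)=\tau\otimes y_\tau$ and $s\cdot y_\tau=\operatorname{sgn}(s)\,y_{s\tau s^{-1}}$. Let $R^1_3$ be the quotient of $A(V')$ by the ideal generated by $y_\tau^2$ for all $\tau$, $y_\tau y_{\tau'}+y_{\tau'}y_\tau$ whenever $\tau\tau'=\tau'\tau$, and $y_\tau y_{\tau'}+y_{\tau'}y_{\tau''}+y_{\tau''}y_\tau$ whenever $\tau\tau'=\tau''\tau$. Then $R^2_3$ and $R^1_3$, graded by the degree in the generators, inherit the braided Hopf algebra structures of $A(V)$ and $A(V')$ respectively. There are a group isomorphism $D_3\simeq S_3$ and an isomorphism $R^2_3\simeq R^1_3$ of graded algebras and coalgebras that is compatible, along this group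 isomorphism, with the actions and the coactions. Moreover $R^2_3$ is a TOBA of dimension $12$; its components of degrees $0,1,2,3,4$ have dimensions $1,3,4,3,1$, the components of degree $\ge5$ vanish, and $$1,\ y_0,\ y_1,\ y_2,\ y_0y_1,\ y_1y_2,\ y_0y_2,\ y_1y_0,\ y_0y_1y_0,\ y_0y_1y_2,\ y_1y_0y_2,\ y_0y_1y_0y_2$$ is a basis of $R^2_3$. -/

import Mathlib

open scoped TensorProduct

noncomputable section

namespace YetterDrinfeld

/-! ### Yetter-Drinfeld modules over a group algebra -/

section Modules

variable (k Γ : Type*) [Field k] [Group Γ]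

/-- A linear action of `Γ` and a linear map `M → kΓ ⊗ M`, without any compatibility. -/
structure YDData (M : Type*) [AddCommGroup M] [Module k M] where
  /-- The action `g ⇀ m`. -/
  act : Representation k Γ M
  /-- The coaction `δ(m) = m₍₋₁₎ ⊗ m₍₀₎`. -/
  coact : M →ₗ[k] MonoidAlgebra k Γ ⊗[k] M

/-- Conjugation `x ↦ h x h⁻¹` on the group algebra. -/
def conj (h : Γ) : MonoidAlgebra k Γ →ₗ[k] MonoidAlgebra k Γ :=
  LinearMap.mulLeft k (MonoidAlgebra.of k Γ h) ∘ₗ LinearMap.mulRight k (MonoidAlgebra.of k Γ h⁻¹)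

/-- A left Yetter-Drinfeld module (of any dimension) over the Hopf algebra `kΓ`: a left module
and left comodule with `δ(h m) = h₍₁₎ m₍₋₁₎ S(h₍₃₎) ⊗ h₍₂₎ m₍₀₎`. The latter condition is
linear in `h`, and for `h ∈ Γ` it reads `δ(h m) = h m₍₋₁₎ h⁻¹ ⊗ h m₍₀₎`. -/
structure YDModule (M : Type*) [AddCommGroup M] [Module k M] extends YDData k Γ M where
  coact_coassoc : (TensorProduct.assoc k _ _ M).toLinearMap ∘ₗ
      (Coalgebra.comul (R := k) (A := MonoidAlgebra k Γ)).rTensor M ∘ₗ coact =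
    coact.lTensor (MonoidAlgebra k Γ) ∘ₗ coact
  coact_counit : (Coalgebra.counit (R := k) (A := MonoidAlgebra k Γ)).rTensor M ∘ₗ coact =
    TensorProduct.mk k k M 1
  coact_act : ∀ h : Γ, coact ∘ₗ act h = TensorProduct.map (conj k Γ h) (act h) ∘ₗ coact

variable {k Γ}
variable {M N : Type*} [AddCommGroup M] [Module k M] [AddCommGroup N] [Module k N]

/-- The diagonal action and coaction on `M ⊗ N`:
`h (m ⊗ n) = h m ⊗ h n` and `δ(m ⊗ n) = m₍₋₁₎ n₍₋₁₎ ⊗ (m₍₀₎ ⊗ n₍₀₎)`. -/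
def YDData.tensor (A : YDData k Γ M) (B : YDData k Γ N) : YDData k Γ (M ⊗[k] N) where
  act := A.act.tprod B.act
  coact := (LinearMap.mul' k (MonoidAlgebra k Γ)).rTensor (M ⊗[k] N) ∘ₗ
    (TensorProduct.tensorTensorTensorComm k _ _ _ _).toLinearMap ∘ₗ
    TensorProduct.map A.coact B.coact

variable (k Γ) in
/-- The trivial action and coaction on `k`, the unit object. -/
def YDData.unit : YDData k Γ k where
  act := Representation.trivial k Γ k
  coact := TensorProduct.mk k (MonoidAlgebra k Γ) k 1

/-- The action map `kΓ ⊗ M → M`. -/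
def YDData.actMap (A : YDData k Γ M) : MonoidAlgebra k Γ ⊗[k] M →ₗ[k] M :=
  TensorProduct.lift A.act.asAlgebraHom.toLinearMap

/-- The braiding `c(m ⊗ n) = m₍₋₁₎ n ⊗ m₍₀₎`. -/
def YDData.braiding (A : YDData k Γ M) (B : YDData k Γ N) : M ⊗[k] N →ₗ[k] N ⊗[k] M :=
  B.actMap.rTensor M ∘ₗ
    (TensorProduct.assoc k (MonoidAlgebra k Γ) N M).symm.toLinearMap ∘ₗ
    (TensorProduct.comm k M N).toLinearMap.lTensor (MonoidAlgebra k Γ) ∘ₗ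
    (TensorProduct.assoc k (MonoidAlgebra k Γ) M N).toLinearMap ∘ₗ
    A.coact.rTensor N

/-- Morphisms of Yetter-Drinfeld modules: linear and colinear maps. -/
def IsYDHom (A : YDData k Γ M) (B : YDData k Γ N) (f : M →ₗ[k] N) : Prop :=
  (∀ g : Γ, f ∘ₗ A.act g = B.act g ∘ₗ f) ∧
    B.coact ∘ₗ f = f.lTensor (MonoidAlgebra k Γ) ∘ₗ A.coact

/-- Maps `M → N` that are equivariant and colinear along a group homomorphism `φ : Γ → Γ'`,
where `M` has an action and coaction of `kΓ` and `N` one of `kΓ'`. -/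
def IsYDHomAlong {Γ' : Type*} [Group Γ'] (φ : Γ →* Γ') (A : YDData k Γ M) (B : YDData k Γ' N)
    (f : M →ₗ[k] N) : Prop :=
  (∀ g : Γ, f ∘ₗ A.act g = B.act (φ g) ∘ₗ f) ∧
    B.coact ∘ₗ f =
      TensorProduct.map (MonoidAlgebra.mapDomainLinearMap k k φ) f ∘ₗ A.coact

end Modules

/-! ### Hopf algebras in the Yetter-Drinfeld category -/

section Hopf

variable (k Γ : Type*) [Field k] [Group Γ]

variable {k Γ} in
/-- The product `(m ⊗ m)(id ⊗ c ⊗ id)` on `R ⊗ R`. -/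
def YDData.braidedMul {R : Type*} [Ring R] [Algebra k R] (A : YDData k Γ R) :
    (R ⊗[k] R) ⊗[k] (R ⊗[k] R) →ₗ[k] R ⊗[k] R :=
  TensorProduct.map (LinearMap.mul' k R) (LinearMap.mul' k R) ∘ₗ
    (TensorProduct.assoc k R R (R ⊗[k] R)).symm.toLinearMap ∘ₗ
    ((TensorProduct.assoc k R R R).toLinearMap ∘ₗ
      (A.braiding A).rTensor R ∘ₗ
      (TensorProduct.assoc k R R R).symm.toLinearMap).lTensor R ∘ₗ
    (TensorProduct.assoc k R R (R ⊗[k] R)).toLinearMap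

/-- A Hopf algebra structure in the category of Yetter-Drinfeld modules over `kΓ` on a given
`k`-algebra `R`: all structure maps are morphisms of Yetter-Drinfeld modules, `R` is a coalgebra,
`ε` is multiplicative, `Δ m = (m ⊗ m)(id ⊗ c ⊗ id)(Δ ⊗ Δ)`, and the antipode is the convolution
inverse of the identity. -/
structure YDHopfAlgebra (R : Type*) [Ring R] [Algebra k R] extends
    YDModule k Γ R, Coalgebra k R where
  antipode : R →ₗ[k] R
  mul_hom : IsYDHom (toYDData.tensor toYDData) toYDData (LinearMap.mul' k R)
  unit_hom : IsYDHom (YDData.unit k Γ) toYDData (Algebra.linearMap k R)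
  comul_hom : IsYDHom toYDData (toYDData.tensor toYDData) comul
  counit_hom : IsYDHom toYDData (YDData.unit k Γ) counit
  antipode_hom : IsYDHom toYDData toYDData antipode
  counit_one : counit 1 = 1
  counit_mul : ∀ a b, counit (a * b) = counit a * counit b
  comul_one : comul 1 = 1 ⊗ₜ[k] 1
  comul_mul : comul ∘ₗ LinearMap.mul' k R =
    toYDData.braidedMul ∘ₗ TensorProduct.map comul comul
  antipode_left : LinearMap.mul' k R ∘ₗ antipode.rTensor R ∘ₗ comul =
    Algebra.linearMap k R ∘ₗ counit
  antipode_right : LinearMap.mul' k R ∘ₗ antipode.lTensor R ∘ₗ comul =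
    Algebra.linearMap k R ∘ₗ counit

variable {k Γ}
variable {R : Type*} [Ring R] [Algebra k R]

/-- The space `P(R) = {x | Δ(x) = 1 ⊗ x + x ⊗ 1}` of primitive elements. -/
def YDHopfAlgebra.primitives (T : YDHopfAlgebra k Γ R) : Submodule k R where
  carrier := {x | T.comul x = 1 ⊗ₜ[k] x + x ⊗ₜ[k] 1}
  zero_mem' := by simp
  add_mem' {x y} hx hy := by
    simp only [Set.mem_ofPred_eq] at hx hy ⊢
    rw [map_add, hx, hy, TensorProduct.tmul_add, TensorProduct.add_tmul]
    abel
  smul_mem' c x hx := by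
    simp only [Set.mem_ofPred_eq] at hx ⊢
    rw [map_smul, hx, smul_add, TensorProduct.tmul_smul, ← TensorProduct.smul_tmul' c x]

/-- `R = ⨁ 𝒜 n` is a graded Hopf algebra in the Yetter-Drinfeld category. -/
structure IsGradedHopf (T : YDHopfAlgebra k Γ R) (𝒜 : ℕ → Submodule k R) : Prop where
  isInternal : DirectSum.IsInternal 𝒜
  act_mem : ∀ n g, ∀ x ∈ 𝒜 n, T.act g x ∈ 𝒜 n
  coact_mem : ∀ n, ∀ x ∈ 𝒜 n,
    T.coact x ∈ LinearMap.range ((𝒜 n).subtype.lTensor (MonoidAlgebra k Γ))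
  mul_le : ∀ i j, 𝒜 i * 𝒜 j ≤ 𝒜 (i + j)
  comul_mem : ∀ n, ∀ x ∈ 𝒜 n, T.comul x ∈
    ⨆ ij ∈ Finset.HasAntidiagonal.antidiagonal n, LinearMap.range (TensorProduct.mapIncl (𝒜 ij.1) (𝒜 ij.2))

/-- A TOBA, or braided Hopf algebra of type one (a Nichols algebra): a graded Hopf algebra `R`
in the Yetter-Drinfeld category with `R(0) ≃ k`, `(⨁_{i ≥ 1} R(i))² = ⨁_{i ≥ 2} R(i)` and
`P(R) = R(1)`. -/
structure IsTOBA (T : YDHopfAlgebra k Γ R) (𝒜 : ℕ → Submodule k R) : Prop extends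
    IsGradedHopf T 𝒜 where
  zero_equiv : Nonempty (𝒜 0 ≃ₗ[k] k)
  sq_eq : (⨆ i, ⨆ _ : 1 ≤ i, 𝒜 i) ^ 2 = ⨆ i, ⨆ _ : 2 ≤ i, 𝒜 i
  primitives_eq : T.primitives = 𝒜 1

/-- Let `R` be a quotient algebra of the tensor algebra of a Yetter-Drinfeld module `V`, and
`j : V → R` the canonical map. A braided Hopf algebra structure on `R` is the one inherited from
`A(V)` (the tensor algebra in which the elements of `V` are primitive) if `j` is a morphism of
Yetter-Drinfeld modules with primitive values. As `R` is generated by the image of `j`, there is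
at most one such structure. -/
def YDHopfAlgebra.IsInherited {V : Type*} [AddCommGroup V] [Module k V] (T : YDHopfAlgebra k Γ R)
    (A : YDModule k Γ V) (j : V →ₗ[k] R) : Prop :=
  IsYDHom A.toYDData T.toYDData j ∧ ∀ v, j v ∈ T.primitives

end Hopf

/-! ### The modules `M(g, ρ)` -/

section Induced

variable {k Γ : Type*} [Field k] [Group Γ] (g : Γ)
variable {W : Type*} [AddCommGroup W] [Module k W]
  (ρ : Representation k (Subgroup.centralizer ({g} : Set Γ)) W)

/-- The space underlying `M(g, ρ) = kΓ ⊗_{kΓ_g} W`, for a representation `ρ` of the centralizer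
`Γ_g` on `W`. The element `x ⊗ w` is `Representation.IndV.mk _ ρ x⁻¹ w` (Mathlib's induced
representation lets `h` act by `[x ⊗ w] ↦ [x h⁻¹ ⊗ w]`). -/
abbrev MSpace : Type _ := Representation.IndV (Subgroup.centralizer ({g} : Set Γ)).subtype ρ

/-- The element `x ⊗ w` of `M(g, ρ)`. -/
def MSpace.tmul (x : Γ) (w : W) : MSpace g ρ :=
  Representation.IndV.mk (Subgroup.centralizer ({g} : Set Γ)).subtype ρ x⁻¹ w

/-- The coaction `δ(x ⊗ w) = x g x⁻¹ ⊗ (x ⊗ w)` of `M(g, ρ)`. -/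
def MSpace.coact : MSpace g ρ →ₗ[k] MonoidAlgebra k Γ ⊗[k] MSpace g ρ :=
  Representation.Coinvariants.lift _
    ((Representation.Coinvariants.mk _).lTensor (MonoidAlgebra k Γ) ∘ₗ
      (TensorProduct.assoc k (MonoidAlgebra k Γ) (MonoidAlgebra k Γ) W).toLinearMap ∘ₗ
      ((MonoidAlgebra.mapDomainLinearMap k k fun h : Γ => h⁻¹ * g * h).rTensor _ ∘ₗ
        Coalgebra.comul (R := k) (A := MonoidAlgebra k Γ)).rTensor W)
    (by
      rintro ⟨c, hc⟩
      have hc' : g * c = c * g := Subgroup.mem_centralizer_iff.mp hc g rfl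
      ext h w
      have h1 : h⁻¹ * c⁻¹ * g * (c * h) = h⁻¹ * g * h := by
        rw [show h⁻¹ * c⁻¹ * g * (c * h) = h⁻¹ * c⁻¹ * (g * c) * h by group, hc']
        group
      have h2 := Representation.Coinvariants.mk_self_apply (Representation.tprod
        ((Representation.leftRegular k Γ).comp (Subgroup.centralizer ({g} : Set Γ)).subtype) ρ)
        ⟨c, hc⟩ (MonoidAlgebra.single h 1 ⊗ₜ w)
      simp at h2
      simp [h1, h2])

theorem MSpace.coact_tmul (x : Γ) (w : W) :
    MSpace.coact g ρ (MSpace.tmul g ρ x w) =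
      MonoidAlgebra.of k Γ (x * g * x⁻¹) ⊗ₜ[k] MSpace.tmul g ρ x w := by
  simp [MSpace.coact, MSpace.tmul]

theorem MSpace.act_tmul (h x : Γ) (w : W) :
    Representation.ind (Subgroup.centralizer ({g} : Set Γ)).subtype ρ h (MSpace.tmul g ρ x w) =
      MSpace.tmul g ρ (h * x) w := by
  simp [MSpace.tmul]

theorem MSpace.hom_ext {N : Type*} [AddCommGroup N] [Module k N] {f f' : MSpace g ρ →ₗ[k] N}
    (h : ∀ x w, f (MSpace.tmul g ρ x w) = f' (MSpace.tmul g ρ x w)) : f = f' := by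
  refine Representation.IndV.hom_ext _ _ fun x => LinearMap.ext fun w => ?_
  have := h x⁻¹ w
  simp only [MSpace.tmul, inv_inv] at this
  exact this

/-- The Yetter-Drinfeld module `M(g, ρ)`, with the induced action `h (x ⊗ w) = h x ⊗ w` and the
coaction `δ(x ⊗ w) = x g x⁻¹ ⊗ (x ⊗ w)`. -/
def M : YDModule k Γ (MSpace g ρ) where
  act := Representation.ind (Subgroup.centralizer ({g} : Set Γ)).subtype ρ
  coact := MSpace.coact g ρ
  coact_coassoc := by
    apply MSpace.hom_ext
    intro x w
    simp [MSpace.coact_tmul]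
  coact_counit := by
    apply MSpace.hom_ext
    intro x w
    simp [MSpace.coact_tmul]
  coact_act h := by
    apply MSpace.hom_ext
    intro x w
    simp only [LinearMap.comp_apply, MSpace.act_tmul, MSpace.coact_tmul, TensorProduct.map_tmul]
    simp [conj, mul_assoc]

end Induced

/-! ### The algebras `R¹ₙ` -/

section SymmetricGroup

variable (k : Type*) [Field k] (n : ℕ)

/-- The (not only elementary) transpositions of the symmetric group. -/
abbrev Transposition : Type := {τ : Equiv.Perm (Fin n) // τ.IsSwap}

variable {n} in
/-- The conjugate `s τ s⁻¹` of a transposition. -/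
def Transposition.conj (s : Equiv.Perm (Fin n)) (τ : Transposition n) : Transposition n :=
  ⟨s * τ.1 * s⁻¹, by
    obtain ⟨τ, a, b, hab, rfl⟩ := τ
    exact ⟨s a, s b, fun h => hab (s.injective h), (Equiv.swap_apply_apply s a b).symm⟩⟩

/-- The Yetter-Drinfeld module over the group algebra of the symmetric group with basis `y_τ`
(`τ` a transposition), `δ(y_τ) = τ ⊗ y_τ` and `s y_τ = sgn(s) y_{s τ s⁻¹}`. -/
def V1 : YDModule k (Equiv.Perm (Fin n)) (Transposition n →₀ k) where
  act :=
    { toFun := fun s => ((Equiv.Perm.sign s : ℤ) : k) • Finsupp.lmapDomain k k (.conj s)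
      map_one' := by
        ext τ
        simp [Transposition.conj]
      map_mul' := fun s t => by
        ext τ : 2
        simp [Transposition.conj, mul_assoc, mul_comm] }
  coact := Finsupp.linearCombination k fun τ =>
    MonoidAlgebra.of k (Equiv.Perm (Fin n)) τ.1 ⊗ₜ[k] Finsupp.single τ 1
  coact_coassoc := by
    ext τ
    simp
  coact_counit := by
    ext τ
    simp
  coact_act s := by
    ext τ
    simp [YetterDrinfeld.conj, Transposition.conj, mul_assoc, ← TensorProduct.tmul_smul]

/-- The generator `y_τ` in the tensor algebra `A(V)`. -/
def t1 (τ : Transposition n) : TensorAlgebra k (Transposition n →₀ k) :=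
  TensorAlgebra.ι k (Finsupp.single τ 1)

/-- The defining relations of `R¹ₙ`. -/
inductive Rel1 : TensorAlgebra k (Transposition n →₀ k) →
    TensorAlgebra k (Transposition n →₀ k) → Prop
  | sq (τ : Transposition n) : Rel1 (t1 k n τ * t1 k n τ) 0
  | comm (τ τ' : Transposition n) (h : τ.1 * τ'.1 = τ'.1 * τ.1) :
      Rel1 (t1 k n τ * t1 k n τ' + t1 k n τ' * t1 k n τ) 0
  | braid (τ τ' τ'' : Transposition n) (h : τ.1 * τ'.1 = τ''.1 * τ.1) :
      Rel1 (t1 k n τ * t1 k n τ' + t1 k n τ' * t1 k n τ'' + t1 k n τ'' * t1 k n τ) 0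

/-- The algebra `R¹ₙ = A(V) / I`. -/
abbrev R1 : Type _ := RingQuot (Rel1 k n)

/-- The canonical map `V → R¹ₙ`. -/
def j1 : (Transposition n →₀ k) →ₗ[k] R1 k n :=
  (RingQuot.mkAlgHom k (Rel1 k n)).toLinearMap ∘ₗ TensorAlgebra.ι k

/-- The component of degree `d` of `R¹ₙ`, the image of `V^{⊗ d}`. -/
def grade1 (d : ℕ) : Submodule k (R1 k n) := LinearMap.range (j1 k n) ^ d

end SymmetricGroup

/-! ### The algebras `R²ₚ` -/

section Dihedral

variable (k : Type*) [Field k] (p : ℕ)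

/-- The character of the dihedral group with value `1` on rotations and `-1` on reflections. -/
def dihedralSign : DihedralGroup p →* k where
  toFun
    | .r _ => 1
    | .sr _ => -1
  map_one' := rfl
  map_mul' := by rintro (a | a) (b | b) <;> simp

/-- The reflection `σ`. With the rotation `ρ = r 1`, `ρ^p = σ² = 1` and `σ ρ = ρ^{p-1} σ`; the
power `ρ^i` is `r i`. -/
abbrev sigma : DihedralGroup p := .sr 0

/-- The one-dimensional representation `χ` of the centralizer of `σ` given by the restriction of
the sign; for odd `p` this centralizer is `{1, σ}` and `χ(σ) = -1`. -/
def chi : Representation k (Subgroup.centralizer ({sigma p} : Set (DihedralGroup p))) k :=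
  (Algebra.lmul k k).toMonoidHom.comp ((dihedralSign k p).comp (Subgroup.subtype _))

/-- The Yetter-Drinfeld module `V = M(σ, χ)`. -/
def V2 : YDModule k (DihedralGroup p) (MSpace (sigma p) (chi k p)) := M (sigma p) (chi k p)

/-- The element `y_i = ρ^i ⇀ y_0` of `V`, where `y_0 = 1 ⊗ 1`. -/
def v2 (i : ZMod p) : MSpace (sigma p) (chi k p) :=
  (V2 k p).act (.r i) (MSpace.tmul (sigma p) (chi k p) 1 1)

/-- The generator `y_i` in the tensor algebra `A(V)`. -/
def t2 (i : ZMod p) : TensorAlgebra k (MSpace (sigma p) (chi k p)) :=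
  TensorAlgebra.ι k (v2 k p i)

/-- The defining relations `y_i² = 0` and `∑ᵢ y_i y_{i+s} = 0` (`s ≠ 0`) of `R²ₚ`. -/
inductive Rel2 [NeZero p] : TensorAlgebra k (MSpace (sigma p) (chi k p)) →
    TensorAlgebra k (MSpace (sigma p) (chi k p)) → Prop
  | sq (i : ZMod p) : Rel2 (t2 k p i * t2 k p i) 0
  | sum (s : ZMod p) (hs : s ≠ 0) : Rel2 (∑ i : ZMod p, t2 k p i * t2 k p (i + s)) 0

variable [NeZero p]

/-- The algebra `R²ₚ = A(V) / I`. -/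
abbrev R2 : Type _ := RingQuot (Rel2 k p)

/-- The canonical map `V → R²ₚ`. -/
def j2 : MSpace (sigma p) (chi k p) →ₗ[k] R2 k p :=
  (RingQuot.mkAlgHom k (Rel2 k p)).toLinearMap ∘ₗ TensorAlgebra.ι k

/-- The generator `y_i` of `R²ₚ`. -/
def y (i : ZMod p) : R2 k p := j2 k p (v2 k p i)

/-- The component of degree `d` of `R²ₚ`, the image of `V^{⊗ d}`. -/
def grade2 (d : ℕ) : Submodule k (R2 k p) := LinearMap.range (j2 k p) ^ d

end Dihedral

end YetterDrinfeld

end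

/-!
Both algebras have generators `y_x`, on which the group acts by permutations and signs, and
quadratic relations. The braiding is `c(y_a ⊗ y_b) = -y_{deg a · b} ⊗ y_a`, so in the braided tensor
square the mixed terms of `Δ(y_a) Δ(y_b)` cancel when summed over a relation: the quotient inherits
the braided Hopf algebra structure. The rest follows from the skew derivations `∂_x` that `Δ`
defines. On the one hand their compositions pair the twelve monomials, which span by rewriting, with
twelve words in a signed permutation matrix, so that the monomials form a basis. On the other hand
all `∂_x` vanish together only on the scalars, which forces primitive elements into degree one.
Finally the action of `D₃` on `ℤ/3` identifies it with `S₃`, sends the reflection that fixes `i` to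
the transposition that fixes `i`, and thereby matches the two sets of generators and relations.
-/

noncomputable section

namespace YetterDrinfeld

/-! ### Algebras with quadratic relations -/

section Presentation

variable {k X R B V : Type*} [CommRing k] [Ring R] [Algebra k R] [Ring B] [Algebra k B]
  [AddCommGroup V] [Module k V] {rels : Set (Multiset (X × X))} {y : X → R}

/-- The family `f` satisfies the quadratic relations `∑_{(a, b) ∈ q} f a * f b = 0` for `q ∈ rels`.
A multiset of pairs of indices encodes a relation all of whose coefficients are `1`. -/
def SatisfiesRels (rels : Set (Multiset (X × X))) (f : X → B) : Prop :=
  ∀ q ∈ rels, (q.map fun p => f p.1 * f p.2).sum = 0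

theorem SatisfiesRels.sum_map_eq_zero (hy : SatisfiesRels rels y) (f : R →ₗ[k] V)
    {q : Multiset (X × X)} (hq : q ∈ rels) : (q.map fun p => f (y p.1 * y p.2)).sum = 0 := by
  simpa only [map_multiset_sum, Multiset.map_map, Function.comp_def, map_zero]
    using congrArg f (hy q hq)

theorem SatisfiesRels.map (hy : SatisfiesRels rels y) (F : R →ₐ[k] B) :
    SatisfiesRels rels fun x => F (y x) := fun q hq => by
  simpa only [AlgHom.toLinearMap_apply, map_mul] using hy.sum_map_eq_zero F.toLinearMap hq

variable (k rels) in
/-- The quadratic relations `rels` in the free algebra. -/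
inductive QuadraticRel : FreeAlgebra k X → FreeAlgebra k X → Prop
  | of (q : Multiset (X × X)) (hq : q ∈ rels) :
      QuadraticRel (q.map fun p => FreeAlgebra.ι k p.1 * FreeAlgebra.ι k p.2).sum 0

variable (k rels) in
/-- The algebra with generators indexed by `X` and the quadratic relations `rels`. -/
abbrev PresentedAlgebra : Type _ := RingQuot (QuadraticRel k rels)

namespace PresentedAlgebra

variable (k rels) in
/-- The generators of the algebra presented by `rels`. -/
def gen (x : X) : PresentedAlgebra k rels :=
  RingQuot.mkAlgHom k (QuadraticRel k rels) (FreeAlgebra.ι k x)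

variable (k rels) in
theorem satisfiesRels_gen : SatisfiesRels rels (gen k rels) := fun q hq => by
  simpa only [gen, map_multiset_sum, Multiset.map_map, Function.comp_def, map_mul, map_zero]
    using RingQuot.mkAlgHom_rel k (QuadraticRel.of (k := k) q hq)

/-- The algebra map out of the presented algebra given by a family that satisfies the relations. -/
def lift (f : X → B) (hf : SatisfiesRels rels f) : PresentedAlgebra k rels →ₐ[k] B :=
  RingQuot.liftAlgHom k ⟨FreeAlgebra.lift k f, by
    rintro _ _ ⟨q, hq⟩
    simpa only [map_multiset_sum, Multiset.map_map, Function.comp_def, map_mul,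
      FreeAlgebra.lift_ι_apply, map_zero] using hf q hq⟩

@[simp]
theorem lift_gen (f : X → B) (hf : SatisfiesRels rels f) (x : X) :
    lift (k := k) f hf (gen k rels x) = f x := by
  simp [lift, gen]

theorem algHom_ext {F G : PresentedAlgebra k rels →ₐ[k] B}
    (h : ∀ x, F (gen k rels x) = G (gen k rels x)) : F = G :=
  RingQuot.ringQuot_ext' _ _ _ (FreeAlgebra.hom_ext (funext h))

variable (k rels) in
theorem adjoin_range_gen : Algebra.adjoin k (Set.range (gen k rels)) = ⊤ := by
  rw [show gen k rels = RingQuot.mkAlgHom k (QuadraticRel k rels) ∘ FreeAlgebra.ι k from rfl,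
    Set.range_comp, ← AlgHom.map_adjoin, FreeAlgebra.adjoin_range_ι, Algebra.map_top,
    AlgHom.range_eq_top]
  exact RingQuot.mkAlgHom_surjective k _

end PresentedAlgebra

variable (k rels y) in
/-- The `k`-algebra `R` is presented by the generators `y` and the quadratic relations `rels`. -/
def IsQuadraticPresentation : Prop :=
  ∃ e : PresentedAlgebra k rels ≃ₐ[k] R, ∀ x, e (PresentedAlgebra.gen k rels x) = y x

namespace IsQuadraticPresentation

theorem of_basis (b : Module.Basis X k V) {r : TensorAlgebra k V → TensorAlgebra k V → Prop}
    {y : X → RingQuot r} (hy : ∀ x, y x = RingQuot.mkAlgHom k r (TensorAlgebra.ι k (b x)))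
    (hrels : SatisfiesRels rels y)
    (hr : ∀ ⦃u v⦄, r u v →
      TensorAlgebra.lift k (b.constr k (PresentedAlgebra.gen k rels)) u =
        TensorAlgebra.lift k (b.constr k (PresentedAlgebra.gen k rels)) v) :
    IsQuadraticPresentation k rels y := by
  let F : PresentedAlgebra k rels →ₐ[k] RingQuot r := PresentedAlgebra.lift _ hrels
  let G : RingQuot r →ₐ[k] PresentedAlgebra k rels := RingQuot.liftAlgHom k ⟨_, hr⟩
  have hG (x) : G (y x) = PresentedAlgebra.gen k rels x := by
    simp [G, hy]
  have hFG : F.comp G = AlgHom.id k (RingQuot r) := by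
    refine RingQuot.ringQuot_ext' _ _ _ (TensorAlgebra.hom_ext (b.ext fun x => ?_))
    simp [← hy, hG, F]
  have hGF : G.comp F = AlgHom.id k (PresentedAlgebra k rels) :=
    PresentedAlgebra.algHom_ext fun x => by simp [F, hG]
  exact ⟨AlgEquiv.ofAlgHom F G hFG hGF, fun x => PresentedAlgebra.lift_gen _ hrels x⟩

variable (P : IsQuadraticPresentation k rels y)

include P in
theorem satisfiesRels : SatisfiesRels rels y := by
  obtain ⟨e, he⟩ := P
  simpa only [AlgEquiv.coe_toAlgHom, he] using
    (PresentedAlgebra.satisfiesRels_gen k rels).map (e : PresentedAlgebra k rels →ₐ[k] R)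

/-- The algebra map out of `R` given by a family that satisfies the relations. -/
def lift (f : X → B) (hf : SatisfiesRels rels f) : R →ₐ[k] B :=
  (PresentedAlgebra.lift f hf).comp P.choose.symm

@[simp]
theorem lift_gen (f : X → B) (hf : SatisfiesRels rels f) (x : X) : P.lift f hf (y x) = f x := by
  simp [lift, ← P.choose_spec x]

include P in
theorem adjoin_range_gen : Algebra.adjoin k (Set.range y) = ⊤ := by
  obtain ⟨e, he⟩ := P
  rw [show y = (e : PresentedAlgebra k rels →ₐ[k] R) ∘ PresentedAlgebra.gen k rels from
    funext fun x => (he x).symm, Set.range_comp, ← AlgHom.map_adjoin,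
    PresentedAlgebra.adjoin_range_gen, Algebra.map_top, AlgHom.range_eq_top]
  exact e.surjective

include P in
theorem algHom_ext {F G : R →ₐ[k] B} (h : ∀ x, F (y x) = G (y x)) : F = G := by
  refine AlgHom.ext_of_adjoin_eq_top P.adjoin_range_gen ?_
  rintro _ ⟨x, rfl⟩
  exact h x

include P in
theorem eq_top_of_gen_mul_mem {N : Submodule k R} (h1 : 1 ∈ N) (hN : ∀ x, ∀ a ∈ N, y x * a ∈ N) :
    N = ⊤ := by
  rw [eq_top_iff, ← Algebra.top_toSubmodule, ← P.adjoin_range_gen, Algebra.adjoin_eq_span,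
    Submodule.span_le]
  intro a ha
  induction ha using Submonoid.closure_induction_left with
  | one => exact h1
  | mul_left x hx b _ hb =>
    obtain ⟨x, rfl⟩ := hx
    exact hN x b hb

include P in
theorem span_range_prod_map :
    Submodule.span k (Set.range fun w : List X => (w.map y).prod) = ⊤ := by
  refine P.eq_top_of_gen_mul_mem (Submodule.subset_span ⟨[], rfl⟩) fun x a ha => ?_
  suffices Submodule.span k (Set.range fun w : List X => (w.map y).prod) ≤
      (Submodule.span k (Set.range fun w : List X => (w.map y).prod)).comap
        (LinearMap.mulLeft k (y x)) from this ha
  rw [Submodule.span_le]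
  rintro _ ⟨w, rfl⟩
  exact Submodule.subset_span ⟨x :: w, by simp⟩

include P in
theorem linearMap_ext_of_semiconj {f g : R →ₗ[k] V} (T : X → V → V) (h1 : f 1 = g 1)
    (hf : ∀ x a, f (y x * a) = T x (f a)) (hg : ∀ x a, g (y x * a) = T x (g a)) : f = g := by
  rw [← LinearMap.eqLocus_eq_top]
  refine P.eq_top_of_gen_mul_mem h1 fun x a ha => ?_
  rw [LinearMap.mem_eqLocus] at ha ⊢
  rw [hf, hg, ha]

/-- The augmentation. -/
def counit : R →ₐ[k] k := P.lift (fun _ => 0) fun q _ => by simp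

@[simp]
theorem counit_gen (x : X) : P.counit (y x) = 0 := P.lift_gen _ _ _

/-- The algebra map to the dual numbers with `y x ↦ f x • ε`. -/
def dualNumberHom (f : X → k) : R →ₐ[k] DualNumber k :=
  P.lift (fun x => f x • DualNumber.eps) fun q _ => by simp

@[simp]
theorem dualNumberHom_gen (f : X → k) (x : X) : P.dualNumberHom f (y x) = f x • DualNumber.eps :=
  P.lift_gen _ _ x

theorem fst_dualNumberHom (f : X → k) (a : R) :
    TrivSqZeroExt.fst (P.dualNumberHom f a) = P.counit a := by
  have : (TrivSqZeroExt.fstHom k k k).comp (P.dualNumberHom f) = P.counit :=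
    P.algHom_ext fun x => by simp
  exact DFunLike.congr_fun this a

/-- The derivation at the augmentation with `y x ↦ f x`. It vanishes on products of two or more
generators. -/
def pointDerivation (f : X → k) : R →ₗ[k] k :=
  TrivSqZeroExt.sndHom k k ∘ₗ (P.dualNumberHom f).toLinearMap

@[simp]
theorem pointDerivation_one (f : X → k) : P.pointDerivation f 1 = 0 := by
  simp [pointDerivation]

@[simp]
theorem pointDerivation_gen_mul (f : X → k) (x : X) (a : R) :
    P.pointDerivation f (y x * a) = f x * P.counit a := by
  simp [pointDerivation, ← fst_dualNumberHom P f a]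

end IsQuadraticPresentation

end Presentation

section Powers

variable {k X R : Type*} [CommRing k] [Ring R] [Algebra k R] {y : X → R}

variable (k y) in
/-- The span of the products of `d` elements of the family `y`. -/
abbrev degreePart (d : ℕ) : Submodule k R := Submodule.span k (Set.range y) ^ d

theorem one_mem_degreePart_zero : (1 : R) ∈ degreePart k y 0 := Submodule.one_le.1 (pow_zero _).ge

theorem gen_mul_mem_degreePart (x : X) {d : ℕ} {a : R} (ha : a ∈ degreePart k y d) :
    y x * a ∈ degreePart k y (d + 1) := by
  rw [degreePart, pow_succ']
  exact Submodule.mul_mem_mul (Submodule.subset_span ⟨x, rfl⟩) ha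

theorem degreePart_le {N : ℕ → Submodule k R} (h0 : 1 ∈ N 0)
    (hN : ∀ d x, ∀ a ∈ N d, y x * a ∈ N (d + 1)) (d : ℕ) : degreePart k y d ≤ N d := by
  induction d with
  | zero => rwa [degreePart, pow_zero, Submodule.one_le]
  | succ d ih =>
    rw [degreePart, pow_succ', Submodule.mul_le]
    intro v hv a ha
    suffices Submodule.span k (Set.range y) ≤ (N (d + 1)).comap (LinearMap.mulRight k a) from
      this hv
    rw [Submodule.span_le]
    rintro _ ⟨x, rfl⟩
    exact hN d x a (ih ha)

theorem range_pow_eq_degreePart {V : Type*} [AddCommGroup V] [Module k V] {j : V →ₗ[k] R}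
    {v : X → V} (hv : Submodule.span k (Set.range v) = ⊤) (hj : ∀ x, j (v x) = y x) (d : ℕ) :
    LinearMap.range j ^ d = degreePart k y d := by
  rw [LinearMap.range_eq_map, ← hv, Submodule.map_span, ← Set.range_comp, degreePart,
    show ⇑j ∘ v = y from funext hj]

theorem iSup_pow_sq (N : Submodule k R) :
    (⨆ i, ⨆ _ : 1 ≤ i, N ^ i) ^ 2 = ⨆ i, ⨆ _ : 2 ≤ i, N ^ i := by
  apply le_antisymm
  · simp only [pow_two, Submodule.iSup_mul, Submodule.mul_iSup, iSup_le_iff, ← pow_add]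
    exact fun i hi j hj => le_iSup₂_of_le (f := fun i (_ : 2 ≤ i) => N ^ i) (j + i) (by lia) le_rfl
  · refine iSup₂_le fun i hi => ?_
    obtain ⟨j, rfl⟩ := Nat.exists_eq_add_of_le' hi
    rw [pow_two, show j + 2 = 1 + (j + 1) by ring, pow_add]
    exact mul_le_mul' (le_iSup₂_of_le (f := fun i (_ : 1 ≤ i) => N ^ i) 1 le_rfl le_rfl)
      (le_iSup₂_of_le (f := fun i (_ : 1 ≤ i) => N ^ i) (j + 1) (by lia) le_rfl)

end Powers

/-! ### Coactions and homogeneous elements -/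

section Homogeneous

variable {k Γ M N R : Type*} [Field k] [Group Γ] [AddCommGroup M] [Module k M] [AddCommGroup N]
  [Module k N] [Ring R] [Algebra k R]

theorem conj_of (h g : Γ) :
    conj k Γ h (MonoidAlgebra.of k Γ g) = MonoidAlgebra.of k Γ (h * g * h⁻¹) := by
  simp [conj, mul_assoc]

namespace YDData

/-- The element `m` is homogeneous of degree `g` for the grading by `Γ` that the coaction encodes,
that is `δ(m) = g ⊗ m`. -/
def IsHomogeneous (A : YDData k Γ M) (g : Γ) (m : M) : Prop :=
  A.coact m = MonoidAlgebra.of k Γ g ⊗ₜ m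

variable {A : YDData k Γ M} {B : YDData k Γ N} {g h : Γ} {m : M} {n : N}

theorem IsHomogeneous.smul (hm : A.IsHomogeneous g m) (c : k) : A.IsHomogeneous g (c • m) := by
  rw [IsHomogeneous, map_smul, hm, TensorProduct.tmul_smul]

theorem IsHomogeneous.neg (hm : A.IsHomogeneous g m) : A.IsHomogeneous g (-m) := by
  simpa only [neg_one_smul] using hm.smul (-1)

theorem IsHomogeneous.add {m' : M} (hm : A.IsHomogeneous g m) (hm' : A.IsHomogeneous g m') :
    A.IsHomogeneous g (m + m') := by
  rw [IsHomogeneous, map_add, hm, hm', TensorProduct.tmul_add]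

theorem IsHomogeneous.tmul (hm : A.IsHomogeneous g m) (hn : B.IsHomogeneous h n) :
    (A.tensor B).IsHomogeneous (g * h) (m ⊗ₜ n) := by
  rw [IsHomogeneous] at *
  simp [YDData.tensor, hm, hn]

theorem IsHomogeneous.braiding_tmul (hm : A.IsHomogeneous g m) (n : N) :
    A.braiding B (m ⊗ₜ n) = B.act g n ⊗ₜ m := by
  rw [IsHomogeneous] at hm
  simp [braiding, actMap, hm]

theorem IsHomogeneous.braidedMul_tmul {A : YDData k Γ R} {b : R} (hb : A.IsHomogeneous g b)
    (a c d : R) : A.braidedMul ((a ⊗ₜ b) ⊗ₜ (c ⊗ₜ d)) = (a * A.act g c) ⊗ₜ (b * d) := by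
  simp [braidedMul, hb.braiding_tmul]

section Spanning

variable {Γ' : Type*} [Group Γ'] {C : YDData k Γ' N} {ι : Type*} {v : ι → M} {d : ι → Γ}

theorem coact_comp_eq_map (hv : Submodule.span k (Set.range v) = ⊤)
    (hd : ∀ i, A.IsHomogeneous (d i) (v i)) {f : M →ₗ[k] N}
    {θ : MonoidAlgebra k Γ →ₗ[k] MonoidAlgebra k Γ'} {e : Γ → Γ'}
    (hθ : ∀ g, θ (MonoidAlgebra.of k Γ g) = MonoidAlgebra.of k Γ' (e g))
    (hf : ∀ i, C.IsHomogeneous (e (d i)) (f (v i))) :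
    C.coact ∘ₗ f = TensorProduct.map θ f ∘ₗ A.coact := by
  refine LinearMap.ext_on_range hv fun i => ?_
  rw [LinearMap.comp_apply, LinearMap.comp_apply, hd i, TensorProduct.map_tmul, hθ, hf i]

theorem coact_comp_eq_lTensor (hv : Submodule.span k (Set.range v) = ⊤)
    (hd : ∀ i, A.IsHomogeneous (d i) (v i)) {f : M →ₗ[k] N}
    (hf : ∀ i, B.IsHomogeneous (d i) (f (v i))) :
    B.coact ∘ₗ f = f.lTensor (MonoidAlgebra k Γ) ∘ₗ A.coact :=
  coact_comp_eq_map hv hd (θ := LinearMap.id) (fun _ => rfl) hf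

theorem IsHomogeneous.map {f : M →ₗ[k] N} {θ : MonoidAlgebra k Γ →ₗ[k] MonoidAlgebra k Γ'}
    {e : Γ → Γ'} (hf : C.coact ∘ₗ f = TensorProduct.map θ f ∘ₗ A.coact)
    (hθ : ∀ g, θ (MonoidAlgebra.of k Γ g) = MonoidAlgebra.of k Γ' (e g))
    (hm : A.IsHomogeneous g m) : C.IsHomogeneous (e g) (f m) := by
  have := LinearMap.congr_fun hf m
  rwa [LinearMap.comp_apply, LinearMap.comp_apply, hm, TensorProduct.map_tmul, hθ] at this

/-- The Yetter-Drinfeld module spanned by homogeneous elements whose degrees are conjugated by the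
action. -/
def toYDModule (A : YDData k Γ M) (hv : Submodule.span k (Set.range v) = ⊤)
    (hd : ∀ i, A.IsHomogeneous (d i) (v i))
    (hact : ∀ h i, A.IsHomogeneous (h * d i * h⁻¹) (A.act h (v i))) : YDModule k Γ M where
  toYDData := A
  coact_coassoc := LinearMap.ext_on_range hv fun i => by
    have := hd i
    rw [IsHomogeneous] at this
    simp [this]
  coact_counit := LinearMap.ext_on_range hv fun i => by
    have := hd i
    rw [IsHomogeneous] at this
    simp [this]
  coact_act h := coact_comp_eq_map hv hd (conj_of h) (hact h)

end Spanning

end YDData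

theorem YDModule.isHomogeneous_act (A : YDModule k Γ M) {g : Γ} {m : M}
    (hm : A.toYDData.IsHomogeneous g m) (h : Γ) :
    A.toYDData.IsHomogeneous (h * g * h⁻¹) (A.act h m) :=
  hm.map (e := fun g => h * g * h⁻¹) (A.coact_act h) (conj_of h)

end Homogeneous

/-! ### Braided Hopf algebras with quadratic relations -/

/-- Data that make the algebra with generators `y_x`, `x ∈ X`, and quadratic relations `rels` a
braided Hopf algebra over `kΓ`: a `Γ`-set `X`, degrees in `Γ` and a character `χ`, encoding the
Yetter-Drinfeld module with basis `y_x`, action `g y_x = χ(g) y_{g x}` and coaction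
`δ(y_x) = deg x ⊗ y_x`, and a `Γ`-stable set of homogeneous relations. By `χ_deg` the braiding is
`c(y_a ⊗ y_b) = -y_{deg a • b} ⊗ y_a`, hence `map_braid` says that `c` is `-1` on the relations. -/
structure BraidedQuadraticDatum (k Γ X : Type*) [Field k] [Group Γ] [MulAction Γ X] where
  deg : X → Γ
  χ : Γ →* k
  rels : Set (Multiset (X × X))
  deg_smul : ∀ g x, deg (g • x) = g * deg x * g⁻¹
  χ_deg : ∀ x, χ (deg x) = -1
  smul_mem_rels : ∀ g : Γ, ∀ q ∈ rels, q.map (g • ·) ∈ rels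
  deg_mul_deg : ∀ q ∈ rels, ∃ h, ∀ p ∈ q, deg p.1 * deg p.2 = h
  map_braid : ∀ q ∈ rels, q.map (fun p => (deg p.1 • p.2, p.1)) = q

namespace BraidedQuadraticDatum

variable {k Γ X R : Type*} [Field k] [Group Γ] [MulAction Γ X] [Ring R] [Algebra k R] {y : X → R}
  (D : BraidedQuadraticDatum k Γ X) (P : IsQuadraticPresentation k D.rels y)

section Action

theorem satisfiesRels_smul (hy : SatisfiesRels D.rels y) (g : Γ) :
    SatisfiesRels D.rels fun x => D.χ g • y (g • x) := fun q hq => by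
  have h := hy _ (D.smul_mem_rels g q hq)
  rw [Multiset.map_map] at h
  simpa only [smul_mul_smul_comm, Multiset.smul_sum, Multiset.map_map, Function.comp_def,
    Prod.smul_fst, Prod.smul_snd, smul_zero] using congrArg ((D.χ g * D.χ g) • ·) h

/-- The action of an element of `Γ`, as an algebra map. -/
def actHom (g : Γ) : R →ₐ[k] R := P.lift _ (D.satisfiesRels_smul P.satisfiesRels g)

@[simp]
theorem actHom_gen (g : Γ) (x : X) : D.actHom P g (y x) = D.χ g • y (g • x) := P.lift_gen _ _ _

theorem actHom_one : D.actHom P 1 = AlgHom.id k R := P.algHom_ext fun x => by simp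

theorem actHom_mul (g h : Γ) : D.actHom P (g * h) = (D.actHom P g).comp (D.actHom P h) :=
  P.algHom_ext fun x => by
    simp only [actHom_gen, AlgHom.comp_apply, map_smul, map_mul, SemigroupAction.mul_smul,
      smul_comm (D.χ g)]

/-- The action of `Γ` by algebra automorphisms with `g y_x = χ(g) y_{g x}`. -/
def act : Representation k Γ R where
  toFun g := (D.actHom P g).toLinearMap
  map_one' := congrArg AlgHom.toLinearMap (D.actHom_one P)
  map_mul' g h := congrArg AlgHom.toLinearMap (D.actHom_mul P g h)

@[simp]
theorem act_gen (g : Γ) (x : X) : D.act P g (y x) = D.χ g • y (g • x) := D.actHom_gen P g x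

theorem act_mul (g : Γ) (a b : R) : D.act P g (a * b) = D.act P g a * D.act P g b :=
  map_mul (D.actHom P g) a b

@[simp]
theorem act_one (g : Γ) : D.act P g (1 : R) = 1 := map_one (D.actHom P g)

theorem act_act (g h : Γ) (a : R) : D.act P g (D.act P h a) = D.act P (g * h) a :=
  (LinearMap.congr_fun (map_mul (D.act P) g h) a).symm

theorem act_gen_mul (g : Γ) (x : X) (a : R) :
    D.act P g (y x * a) = D.χ g • (y (g • x) * D.act P g a) := by
  rw [act_mul, act_gen, smul_mul_assoc]

theorem act_deg_gen_mul (x x' : X) (a : R) :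
    D.act P (D.deg x) (y x' * a) = -(y (D.deg x • x') * D.act P (D.deg x) a) := by
  rw [act_gen_mul, χ_deg, neg_one_smul]

theorem counit_act (g : Γ) (a : R) : P.counit (D.act P g a) = P.counit a := by
  have : P.counit.comp (D.actHom P g) = P.counit := P.algHom_ext fun x => by simp
  exact DFunLike.congr_fun this a

theorem act_prod_map (g : Γ) (w : List X) :
    D.act P g (w.map y).prod = D.χ g ^ w.length • ((w.map (g • ·)).map y).prod := by
  induction w with
  | nil => simp
  | cons x w ih =>
    rw [List.map_cons, List.prod_cons, act_gen_mul, ih, mul_smul_comm, smul_smul, ← pow_succ']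
    rfl

end Action

section Coaction

theorem satisfiesRels_deg_tmul (hy : SatisfiesRels D.rels y) :
    SatisfiesRels D.rels fun x => MonoidAlgebra.of k Γ (D.deg x) ⊗ₜ[k] y x := fun q hq => by
  obtain ⟨h, hh⟩ := D.deg_mul_deg q hq
  rw [← hy.sum_map_eq_zero (TensorProduct.mk k _ _ (MonoidAlgebra.of k Γ h)) hq]
  refine congrArg _ (Multiset.map_congr rfl fun p hp => ?_)
  rw [Algebra.TensorProduct.tmul_mul_tmul, ← map_mul, hh p hp]
  rfl

/-- The coaction with `δ(y_x) = deg x ⊗ y_x`, as an algebra map. -/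
def coact : R →ₐ[k] MonoidAlgebra k Γ ⊗[k] R :=
  P.lift _ (D.satisfiesRels_deg_tmul P.satisfiesRels)

@[simp]
theorem coact_gen (x : X) : D.coact P (y x) = MonoidAlgebra.of k Γ (D.deg x) ⊗ₜ y x :=
  P.lift_gen _ _ _

/-- The action and coaction on the presented algebra. -/
def ydData : YDData k Γ R where
  act := D.act P
  coact := (D.coact P).toLinearMap

theorem ydData_act : (D.ydData P).act = D.act P := rfl

theorem isHomogeneous_gen (x : X) : (D.ydData P).IsHomogeneous (D.deg x) (y x) := D.coact_gen P x

theorem isHomogeneous_one : (D.ydData P).IsHomogeneous 1 (1 : R) := by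
  exact (map_one (D.coact P)).trans (by rw [map_one, Algebra.TensorProduct.one_def])

variable {D P} in
theorem isHomogeneous_mul {g h : Γ} {a b : R} (ha : (D.ydData P).IsHomogeneous g a)
    (hb : (D.ydData P).IsHomogeneous h b) : (D.ydData P).IsHomogeneous (g * h) (a * b) := by
  have ha : D.coact P a = _ := ha
  have hb : D.coact P b = _ := hb
  exact (map_mul (D.coact P) a b).trans
    (by rw [ha, hb, Algebra.TensorProduct.tmul_mul_tmul, map_mul])

theorem isHomogeneous_prod_map (w : List X) :
    (D.ydData P).IsHomogeneous (w.map D.deg).prod (w.map y).prod := by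
  induction w with
  | nil => exact D.isHomogeneous_one P
  | cons x w ih => exact isHomogeneous_mul (D.isHomogeneous_gen P x) ih

theorem prod_map_deg_smul (g : Γ) (w : List X) :
    ((w.map (g • ·)).map D.deg).prod = g * (w.map D.deg).prod * g⁻¹ := by
  induction w with
  | nil => simp
  | cons x w ih =>
    rw [List.map_cons, List.map_cons, List.prod_cons, ih, deg_smul, List.map_cons, List.prod_cons]
    group

/-- The Yetter-Drinfeld module structure on the presented algebra. -/
def ydModule : YDModule k Γ R :=
  (D.ydData P).toYDModule P.span_range_prod_map (D.isHomogeneous_prod_map P) fun g w => by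
    rw [← prod_map_deg_smul, ydData_act, act_prod_map]
    exact (D.isHomogeneous_prod_map P _).smul _

include P in
theorem span_range_prod_map_tmul :
    Submodule.span k (Set.range fun w : List X × List X =>
      (w.1.map y).prod ⊗ₜ[k] (w.2.map y).prod) = ⊤ := by
  rw [← TensorProduct.map₂_mk_top_top_eq_top, ← P.span_range_prod_map,
    Submodule.map₂_span_span, Set.image2_range]
  rfl

theorem isHomogeneous_prod_map_tmul (w : List X × List X) :
    ((D.ydData P).tensor (D.ydData P)).IsHomogeneous
      ((w.1.map D.deg).prod * (w.2.map D.deg).prod) ((w.1.map y).prod ⊗ₜ[k] (w.2.map y).prod) :=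
  (D.isHomogeneous_prod_map P w.1).tmul (D.isHomogeneous_prod_map P w.2)

end Coaction

section Coproduct

/-- A quantum binomial formula: the braiding is `-1` on the relations, so the mixed terms cancel. -/
theorem satisfiesRels_add {B : Type*} [Ring B] {L N : X → B} (hL : SatisfiesRels D.rels L)
    (hN : SatisfiesRels D.rels N)
    (hNL : ∀ a b, N a * L b = -(L (D.deg a • b) * N a)) :
    SatisfiesRels D.rels (L + N) := fun q hq => by
  have hmixed : (q.map fun p => L p.1 * N p.2).sum + (q.map fun p => N p.1 * L p.2).sum = 0 := by
    conv_lhs => enter [1]; rw [← D.map_braid q hq]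
    rw [Multiset.map_map, ← Multiset.sum_map_add]
    simp [hNL]
  calc (q.map fun p => (L + N) p.1 * (L + N) p.2).sum
    _ = ((q.map fun p => L p.1 * L p.2).sum + (q.map fun p => N p.1 * N p.2).sum) +
        ((q.map fun p => L p.1 * N p.2).sum + (q.map fun p => N p.1 * L p.2).sum) := by
      simp only [← Multiset.sum_map_add, Pi.add_apply]
      refine congrArg _ (Multiset.map_congr rfl fun p _ => ?_)
      noncomm_ring
    _ = 0 := by rw [hL q hq, hN q hq, hmixed, add_zero, add_zero]

theorem satisfiesRels_mulLeft_rTensor (hy : SatisfiesRels D.rels y) :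
    SatisfiesRels D.rels fun x => (LinearMap.mulLeft k (y x)).rTensor R :=
  hy.map ((Module.End.rTensorAlgHom k R R).comp (Algebra.lmul k R))

theorem satisfiesRels_act_map_mulLeft :
    SatisfiesRels D.rels fun x =>
      (TensorProduct.map (D.act P (D.deg x)) (LinearMap.mulLeft k (y x)) :
        Module.End k (R ⊗[k] R)) := fun q hq => by
  obtain ⟨h, hh⟩ := D.deg_mul_deg q hq
  rw [← P.satisfiesRels.sum_map_eq_zero
    (TensorProduct.mapBilinear (.id k) R R R R (D.act P h) ∘ₗ LinearMap.mul k R) hq]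
  refine congrArg _ (Multiset.map_congr rfl fun p hp => ?_)
  ext a b
  simp [← hh p hp, mul_assoc]

theorem satisfiesRels_comul : SatisfiesRels D.rels fun x =>
    ((LinearMap.mulLeft k (y x)).rTensor R +
      TensorProduct.map (D.act P (D.deg x)) (LinearMap.mulLeft k (y x)) :
        Module.End k (R ⊗[k] R)) :=
  D.satisfiesRels_add (D.satisfiesRels_mulLeft_rTensor P.satisfiesRels)
    (D.satisfiesRels_act_map_mulLeft P) fun a b => by
      ext c d
      simp [act_deg_gen_mul, TensorProduct.neg_tmul]

/-- Left multiplication by `Δ(a)` in the braided tensor square `R ⊗ R`, as an algebra map in `a`.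
Constructing it as a map into the endomorphisms of `R ⊗ R` avoids proving first that the braided
tensor square is an associative algebra. -/
def comulHom : R →ₐ[k] Module.End k (R ⊗[k] R) := P.lift _ (D.satisfiesRels_comul P)

@[simp]
theorem comulHom_gen_tmul (x : X) (a b : R) : D.comulHom P (y x) (a ⊗ₜ b) =
    (y x * a) ⊗ₜ b + D.act P (D.deg x) a ⊗ₜ (y x * b) := by
  rw [comulHom, P.lift_gen]
  simp

/-- The coproduct, for which the generators are primitive. -/
def comul : R →ₗ[k] R ⊗[k] R :=
  LinearMap.applyₗ (R := k) (M₂ := R ⊗[k] R) (1 ⊗ₜ 1) ∘ₗ (D.comulHom P).toLinearMap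

@[simp]
theorem comul_one : D.comul P 1 = 1 ⊗ₜ 1 := by
  simp [comul]

theorem comul_mul (a b : R) : D.comul P (a * b) = D.comulHom P a (D.comul P b) := by
  simp [comul]

theorem comul_gen (x : X) : D.comul P (y x) = y x ⊗ₜ 1 + 1 ⊗ₜ y x := by
  simp [comul]

end Coproduct

section Antipode

theorem satisfiesRels_antipode : SatisfiesRels D.rels fun x =>
    (-(LinearMap.mulRight k (y x) ∘ₗ D.act P (D.deg x)) : Module.End k R) := fun q hq => by
  obtain ⟨h, hh⟩ := D.deg_mul_deg q hq
  have hsum := P.satisfiesRels.sum_map_eq_zero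
    (-(LinearMap.lcomp k R (D.act P h) ∘ₗ (LinearMap.mul k R).flip)) hq
  rw [← D.map_braid q hq, Multiset.map_map] at hsum
  rw [← hsum]
  refine congrArg _ (Multiset.map_congr rfl fun p hp => ?_)
  ext a
  simp [← hh p hp, act_mul, χ_deg, mul_assoc]

/-- The algebra map `a ↦ (S(b) ↦ S(a b))`. -/
def antipodeHom : R →ₐ[k] Module.End k R := P.lift _ (D.satisfiesRels_antipode P)

@[simp]
theorem antipodeHom_gen (x : X) (a : R) :
    D.antipodeHom P (y x) a = -(D.act P (D.deg x) a * y x) := by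
  rw [antipodeHom, P.lift_gen]
  simp

/-- The antipode. -/
def antipode : R →ₗ[k] R :=
  LinearMap.applyₗ (R := k) (M₂ := R) 1 ∘ₗ (D.antipodeHom P).toLinearMap

@[simp]
theorem antipode_one : D.antipode P 1 = 1 := by
  simp [antipode]

theorem antipode_gen_mul (x : X) (a : R) :
    D.antipode P (y x * a) = -(D.act P (D.deg x) (D.antipode P a) * y x) := by
  simp [antipode]

end Antipode

end BraidedQuadraticDatum

namespace BraidedQuadraticDatum

variable {k Γ X R : Type*} [Field k] [Group Γ] [MulAction Γ X] [Ring R] [Algebra k R] {y : X → R}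
  (D : BraidedQuadraticDatum k Γ X) (P : IsQuadraticPresentation k D.rels y)

variable {D P} in
theorem isHomogeneous_act {g : Γ} {a : R} (ha : (D.ydData P).IsHomogeneous g a) (h : Γ) :
    (D.ydData P).IsHomogeneous (h * g * h⁻¹) (D.act P h a) :=
  (D.ydModule P).isHomogeneous_act ha h

section Morphisms

theorem isYDHom_mul : IsYDHom ((D.ydData P).tensor (D.ydData P)) (D.ydData P)
    (LinearMap.mul' k R) :=
  ⟨fun g => TensorProduct.ext' fun a b => (D.act_mul P g a b).symm,
    YDData.coact_comp_eq_lTensor (span_range_prod_map_tmul D P) (D.isHomogeneous_prod_map_tmul P)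
      fun w => isHomogeneous_mul (D.isHomogeneous_prod_map P w.1) (D.isHomogeneous_prod_map P w.2)⟩

theorem isYDHom_unit : IsYDHom (YDData.unit k Γ) (D.ydData P) (Algebra.linearMap k R) :=
  ⟨fun g => LinearMap.ext_ring (by simp [YDData.unit, ydData]),
    LinearMap.ext_ring (by simp [YDData.unit, ydData, Algebra.TensorProduct.one_def])⟩

theorem isYDHom_counit : IsYDHom (D.ydData P) (YDData.unit k Γ) P.counit.toLinearMap := by
  refine ⟨fun g => LinearMap.ext (D.counit_act P g),
    YDData.coact_comp_eq_lTensor P.span_range_prod_map (D.isHomogeneous_prod_map P) fun w => ?_⟩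
  cases w with
  | nil => simp [YDData.IsHomogeneous, YDData.unit, MonoidAlgebra.one_def]
  | cons x w => simp [YDData.IsHomogeneous]

theorem map_act_comulHom_gen (h : Γ) (x : X) :
    TensorProduct.map (D.act P h) (D.act P h) ∘ₗ D.comulHom P (y x) =
      D.χ h • D.comulHom P (y (h • x)) ∘ₗ TensorProduct.map (D.act P h) (D.act P h) := by
  ext a b
  simp [act_gen_mul, act_act, deg_smul, TensorProduct.smul_tmul', -map_mul]

theorem comul_act (h : Γ) : D.comul P ∘ₗ D.act P h =
    TensorProduct.map (D.act P h) (D.act P h) ∘ₗ D.comul P := by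
  refine P.linearMap_ext_of_semiconj
    (fun x z => D.χ h • D.comulHom P (y (h • x)) z) (by simp) (fun x a => ?_) fun x a => ?_
  · rw [LinearMap.comp_apply, act_gen_mul, map_smul, comul_mul, LinearMap.comp_apply]
  · rw [LinearMap.comp_apply, comul_mul]
    exact LinearMap.congr_fun (D.map_act_comulHom_gen P h x) (D.comul P a)

theorem tensor_coact_comulHom_gen (x : X) :
    ((D.ydData P).tensor (D.ydData P)).coact ∘ₗ D.comulHom P (y x) =
      TensorProduct.map (LinearMap.mulLeft k (MonoidAlgebra.of k Γ (D.deg x)))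
        (D.comulHom P (y x)) ∘ₗ ((D.ydData P).tensor (D.ydData P)).coact := by
  refine YDData.coact_comp_eq_map (e := (D.deg x * ·)) (span_range_prod_map_tmul D P)
    (D.isHomogeneous_prod_map_tmul P) (fun g => (map_mul _ _ _).symm) fun w => ?_
  have hx := D.isHomogeneous_gen P x
  have h1 := D.isHomogeneous_prod_map P w.1
  have h2 := D.isHomogeneous_prod_map P w.2
  have hr := (isHomogeneous_act h1 (D.deg x)).tmul (isHomogeneous_mul hx h2)
  rw [show D.deg x * (w.1.map D.deg).prod * (D.deg x)⁻¹ * (D.deg x * (w.2.map D.deg).prod) =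
    D.deg x * (w.1.map D.deg).prod * (w.2.map D.deg).prod by group] at hr
  rw [comulHom_gen_tmul, ← mul_assoc]
  exact ((isHomogeneous_mul hx h1).tmul h2).add hr

theorem isHomogeneous_comul_prod_map (w : List X) :
    ((D.ydData P).tensor (D.ydData P)).IsHomogeneous (w.map D.deg).prod
      (D.comul P (w.map y).prod) := by
  induction w with
  | nil => simpa using (D.isHomogeneous_one P).tmul (D.isHomogeneous_one P)
  | cons x w ih =>
    rw [List.map_cons, List.prod_cons, List.map_cons, List.prod_cons, comul_mul]
    exact ih.map (e := (D.deg x * ·)) (D.tensor_coact_comulHom_gen P x)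
      fun g => (map_mul _ _ _).symm

theorem isYDHom_comul :
    IsYDHom (D.ydData P) ((D.ydData P).tensor (D.ydData P)) (D.comul P) :=
  ⟨D.comul_act P, YDData.coact_comp_eq_lTensor P.span_range_prod_map (D.isHomogeneous_prod_map P)
    (D.isHomogeneous_comul_prod_map P)⟩

theorem antipode_act (h : Γ) : D.antipode P ∘ₗ D.act P h = D.act P h ∘ₗ D.antipode P := by
  refine P.linearMap_ext_of_semiconj
    (fun x b => -(D.χ h • (D.act P (D.deg (h • x)) b * y (h • x)))) (by simp) (fun x a => ?_)
    fun x a => ?_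
  · rw [LinearMap.comp_apply, act_gen_mul, map_smul, antipode_gen_mul, smul_neg,
      LinearMap.comp_apply]
  · rw [LinearMap.comp_apply, antipode_gen_mul, map_neg, act_mul, act_act, act_gen, deg_smul,
      LinearMap.comp_apply, act_act, inv_mul_cancel_right, mul_smul_comm]

theorem isHomogeneous_antipode_prod_map (w : List X) :
    (D.ydData P).IsHomogeneous (w.map D.deg).prod (D.antipode P (w.map y).prod) := by
  induction w with
  | nil => simpa using D.isHomogeneous_one P
  | cons x w ih =>
    rw [List.map_cons, List.prod_cons, List.map_cons, List.prod_cons, antipode_gen_mul]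
    have := isHomogeneous_mul (isHomogeneous_act ih (D.deg x)) (D.isHomogeneous_gen P x)
    rw [inv_mul_cancel_right] at this
    exact this.neg

theorem isYDHom_antipode : IsYDHom (D.ydData P) (D.ydData P) (D.antipode P) :=
  ⟨D.antipode_act P, YDData.coact_comp_eq_lTensor P.span_range_prod_map
    (D.isHomogeneous_prod_map P) (D.isHomogeneous_antipode_prod_map P)⟩

end Morphisms

section HopfAxioms

theorem comulHom_gen_braidedMul (x : X) (c d : R) :
    D.comulHom P (y x) ∘ₗ (TensorProduct.curry (D.ydData P).braidedMul).flip (c ⊗ₜ d) =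
      (TensorProduct.curry (D.ydData P).braidedMul).flip (c ⊗ₜ d) ∘ₗ D.comulHom P (y x) := by
  refine LinearMap.ext_on_range (span_range_prod_map_tmul D P) fun w => ?_
  have h2 := D.isHomogeneous_prod_map P w.2
  have hx2 := isHomogeneous_mul (D.isHomogeneous_gen P x) h2
  simp only [LinearMap.comp_apply, LinearMap.flip_apply, TensorProduct.curry_apply,
    comulHom_gen_tmul, map_add, h2.braidedMul_tmul, hx2.braidedMul_tmul, ydData_act, act_mul,
    act_act, mul_assoc]

theorem comulHom_eq_braidedMul :
    (D.comulHom P).toLinearMap = TensorProduct.curry (D.ydData P).braidedMul ∘ₗ D.comul P := by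
  refine P.linearMap_ext_of_semiconj (fun x F => D.comulHom P (y x) ∘ₗ F) ?_
    (fun x a => map_mul (D.comulHom P) (y x) a) fun x a => TensorProduct.ext' fun c d => ?_
  · ext a b
    simp [(D.isHomogeneous_one P).braidedMul_tmul, ydData_act]
  · rw [LinearMap.comp_apply, comul_mul]
    exact (LinearMap.congr_fun (D.comulHom_gen_braidedMul P x c d) (D.comul P a)).symm

theorem comul_comp_mul : D.comul P ∘ₗ LinearMap.mul' k R =
    (D.ydData P).braidedMul ∘ₗ TensorProduct.map (D.comul P) (D.comul P) :=
  TensorProduct.ext' fun a b => (D.comul_mul P a b).trans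
    (LinearMap.congr_fun (LinearMap.congr_fun (D.comulHom_eq_braidedMul P) a) (D.comul P b))

theorem assoc_rTensor_comul_comulHom_gen (x : X) :
    (TensorProduct.assoc k R R R).toLinearMap ∘ₗ (D.comul P).rTensor R ∘ₗ D.comulHom P (y x) =
      ((LinearMap.mulLeft k (y x)).rTensor (R ⊗[k] R) +
        TensorProduct.map (D.act P (D.deg x)) (D.comulHom P (y x))) ∘ₗ
          (TensorProduct.assoc k R R R).toLinearMap ∘ₗ (D.comul P).rTensor R := by
  refine TensorProduct.ext' fun a b => ?_
  have hact : D.comul P (D.act P (D.deg x) a) = _ :=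
    LinearMap.congr_fun (D.comul_act P (D.deg x)) a
  simp only [LinearMap.comp_apply, LinearEquiv.coe_coe, comulHom_gen_tmul, map_add,
    LinearMap.rTensor_tmul, comul_mul, hact]
  induction D.comul P a with
  | zero => simp
  | add u v hu hv =>
    simp only [map_add, TensorProduct.add_tmul, ← hu, ← hv]
    abel
  | tmul c d => simp [TensorProduct.add_tmul, TensorProduct.tmul_add, add_assoc]

theorem lTensor_comul_comulHom_gen (x : X) : (D.comul P).lTensor R ∘ₗ D.comulHom P (y x) =
    ((LinearMap.mulLeft k (y x)).rTensor (R ⊗[k] R) +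
      TensorProduct.map (D.act P (D.deg x)) (D.comulHom P (y x))) ∘ₗ (D.comul P).lTensor R :=
  TensorProduct.ext' fun a b => by simp [comul_mul]

theorem coassoc :
    (TensorProduct.assoc k R R R).toLinearMap ∘ₗ (D.comul P).rTensor R ∘ₗ D.comul P =
      (D.comul P).lTensor R ∘ₗ D.comul P := by
  refine P.linearMap_ext_of_semiconj (fun x => (LinearMap.mulLeft k (y x)).rTensor (R ⊗[k] R) +
    TensorProduct.map (D.act P (D.deg x)) (D.comulHom P (y x))) (by simp) (fun x a => ?_)
    fun x a => ?_
  · rw [LinearMap.comp_apply, LinearMap.comp_apply, comul_mul]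
    exact LinearMap.congr_fun (D.assoc_rTensor_comul_comulHom_gen P x) (D.comul P a)
  · rw [LinearMap.comp_apply, comul_mul]
    exact LinearMap.congr_fun (D.lTensor_comul_comulHom_gen P x) (D.comul P a)

theorem rTensor_counit_comul :
    P.counit.toLinearMap.rTensor R ∘ₗ D.comul P = TensorProduct.mk k k R 1 := by
  have h (x : X) : P.counit.toLinearMap.rTensor R ∘ₗ D.comulHom P (y x) =
      (LinearMap.mulLeft k (y x)).lTensor k ∘ₗ P.counit.toLinearMap.rTensor R :=
    TensorProduct.ext' fun a b => by simp [counit_act]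
  refine P.linearMap_ext_of_semiconj (fun x => (LinearMap.mulLeft k (y x)).lTensor k) (by simp)
    (fun x a => ?_) (by simp)
  rw [LinearMap.comp_apply, comul_mul]
  exact LinearMap.congr_fun (h x) (D.comul P a)

theorem lTensor_counit_comul :
    P.counit.toLinearMap.lTensor R ∘ₗ D.comul P = (TensorProduct.mk k R k).flip 1 := by
  have h (x : X) : P.counit.toLinearMap.lTensor R ∘ₗ D.comulHom P (y x) =
      (LinearMap.mulLeft k (y x)).rTensor k ∘ₗ P.counit.toLinearMap.lTensor R :=
    TensorProduct.ext' fun a b => by simp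
  refine P.linearMap_ext_of_semiconj (fun x => (LinearMap.mulLeft k (y x)).rTensor k) (by simp)
    (fun x a => ?_) (by simp)
  rw [LinearMap.comp_apply, comul_mul]
  exact LinearMap.congr_fun (h x) (D.comul P a)

theorem antipode_left : LinearMap.mul' k R ∘ₗ (D.antipode P).rTensor R ∘ₗ D.comul P =
    Algebra.linearMap k R ∘ₗ P.counit.toLinearMap := by
  have h (x : X) : LinearMap.mul' k R ∘ₗ (D.antipode P).rTensor R ∘ₗ D.comulHom P (y x) = 0 :=
    TensorProduct.ext' fun a b => by
      have hact : D.antipode P (D.act P (D.deg x) a) = D.act P (D.deg x) (D.antipode P a) :=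
        LinearMap.congr_fun (D.antipode_act P (D.deg x)) a
      simp [antipode_gen_mul, hact, mul_assoc]
  refine P.linearMap_ext_of_semiconj (fun _ _ => 0) (by simp) (fun x a => ?_) (by simp)
  rw [LinearMap.comp_apply, LinearMap.comp_apply, comul_mul]
  exact LinearMap.congr_fun (h x) (D.comul P a)

theorem antipode_right : LinearMap.mul' k R ∘ₗ (D.antipode P).lTensor R ∘ₗ D.comul P =
    Algebra.linearMap k R ∘ₗ P.counit.toLinearMap := by
  have h (x : X) : LinearMap.mul' k R ∘ₗ (D.antipode P).lTensor R ∘ₗ D.comulHom P (y x) =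
      (LinearMap.mulLeft k (y x) - LinearMap.mulRight k (y x) ∘ₗ D.act P (D.deg x)) ∘ₗ
        LinearMap.mul' k R ∘ₗ (D.antipode P).lTensor R :=
    TensorProduct.ext' fun a b => by
      simp [antipode_gen_mul, act_mul, mul_assoc, sub_eq_add_neg]
  refine P.linearMap_ext_of_semiconj
    (fun x b => y x * b - D.act P (D.deg x) b * y x) (by simp) (fun x a => ?_) fun x a => ?_
  · rw [LinearMap.comp_apply, LinearMap.comp_apply, comul_mul]
    exact LinearMap.congr_fun (h x) (D.comul P a)
  · simp [Algebra.algebraMap_eq_smul_one]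

/-- The braided Hopf algebra structure on the presented algebra in which the generators are
primitive. -/
def hopf : YDHopfAlgebra k Γ R where
  toYDModule := D.ydModule P
  comul := D.comul P
  counit := P.counit.toLinearMap
  coassoc := D.coassoc P
  rTensor_counit_comp_comul := D.rTensor_counit_comul P
  lTensor_counit_comp_comul := D.lTensor_counit_comul P
  antipode := D.antipode P
  mul_hom := D.isYDHom_mul P
  unit_hom := D.isYDHom_unit P
  comul_hom := D.isYDHom_comul P
  counit_hom := D.isYDHom_counit P
  antipode_hom := D.isYDHom_antipode P
  counit_one := map_one P.counit
  counit_mul := map_mul P.counit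
  comul_one := D.comul_one P
  comul_mul := D.comul_comp_mul P
  antipode_left := D.antipode_left P
  antipode_right := D.antipode_right P

end HopfAxioms

end BraidedQuadraticDatum

/-! ### Skew derivations and primitive elements -/

section TensorPowers

variable {k X R : Type*} [CommRing k] [Ring R] [Algebra k R] {y : X → R}

variable (k y) in
/-- The component of degree `d` of `R ⊗ R`, for the grading of `R` by the number of generators. -/
abbrev tensorDegreePart (d : ℕ) : Submodule k (R ⊗[k] R) :=
  ⨆ ij ∈ Finset.HasAntidiagonal.antidiagonal d,
    LinearMap.range (TensorProduct.mapIncl (degreePart k y ij.1) (degreePart k y ij.2))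

theorem tmul_mem_tensorDegreePart {i j d : ℕ} (hij : i + j = d) {a b : R}
    (ha : a ∈ degreePart k y i) (hb : b ∈ degreePart k y j) :
    a ⊗ₜ b ∈ tensorDegreePart k y d :=
  Submodule.mem_iSup_of_mem (i, j) (Submodule.mem_iSup_of_mem
    (Finset.HasAntidiagonal.mem_antidiagonal.2 hij) ⟨⟨a, ha⟩ ⊗ₜ ⟨b, hb⟩, rfl⟩)

theorem tensorDegreePart_le {d : ℕ} {N : Submodule k (R ⊗[k] R)}
    (hN : ∀ i j, i + j = d → ∀ a ∈ degreePart k y i, ∀ b ∈ degreePart k y j, a ⊗ₜ b ∈ N) :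
    tensorDegreePart k y d ≤ N := by
  refine iSup₂_le fun ij hij => ?_
  rw [TensorProduct.range_mapIncl, Submodule.map₂_le]
  exact hN ij.1 ij.2 (Finset.HasAntidiagonal.mem_antidiagonal.1 hij)

end TensorPowers

namespace BraidedQuadraticDatum

variable {k Γ X R : Type*} [Field k] [Group Γ] [MulAction Γ X] [Ring R] [Algebra k R] {y : X → R}
  (D : BraidedQuadraticDatum k Γ X) (P : IsQuadraticPresentation k D.rels y)

section Grading

theorem act_mem_degreePart (g : Γ) {d : ℕ} {a : R} (ha : a ∈ degreePart k y d) :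
    D.act P g a ∈ degreePart k y d := by
  refine degreePart_le (N := fun d => (degreePart k y d).comap (D.act P g)) ?_
    (fun d x a ha => ?_) d ha
  · simpa only [Submodule.mem_comap, act_one] using one_mem_degreePart_zero
  · rw [Submodule.mem_comap, act_gen_mul]
    exact Submodule.smul_mem _ _ (gen_mul_mem_degreePart _ ha)

theorem coact_mem_range_lTensor {d : ℕ} {a : R} (ha : a ∈ degreePart k y d) :
    D.coact P a ∈ LinearMap.range ((degreePart k y d).subtype.lTensor (MonoidAlgebra k Γ)) := by
  refine degreePart_le (N := fun d => (LinearMap.range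
    ((degreePart k y d).subtype.lTensor (MonoidAlgebra k Γ))).comap (D.coact P).toLinearMap)
    ⟨1 ⊗ₜ ⟨1, one_mem_degreePart_zero⟩, by simp [Algebra.TensorProduct.one_def]⟩
    (fun d x a ⟨z, hz⟩ => ?_) d ha
  rw [Submodule.mem_comap, AlgHom.toLinearMap_apply, map_mul, coact_gen]
  rw [AlgHom.toLinearMap_apply] at hz
  rw [← hz]
  clear hz
  induction z with
  | zero => simp
  | add u v hu hv => rw [map_add, mul_add]; exact add_mem hu hv
  | tmul c b =>
    exact ⟨(MonoidAlgebra.of k Γ (D.deg x) * c) ⊗ₜ ⟨y x * b, gen_mul_mem_degreePart x b.2⟩,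
      by simp⟩

theorem comul_mem_tensorDegreePart {d : ℕ} {a : R} (ha : a ∈ degreePart k y d) :
    D.comul P a ∈ tensorDegreePart k y d := by
  refine degreePart_le (N := fun d => (tensorDegreePart k y d).comap (D.comul P)) ?_
    (fun d x a ha => ?_) d ha
  · rw [Submodule.mem_comap, comul_one]
    exact tmul_mem_tensorDegreePart (add_zero 0) one_mem_degreePart_zero one_mem_degreePart_zero
  · rw [Submodule.mem_comap] at ha ⊢
    rw [comul_mul, ← Submodule.mem_comap]
    refine tensorDegreePart_le (fun i j hij b hb c hc => ?_) ha
    rw [Submodule.mem_comap, comulHom_gen_tmul]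
    exact add_mem
      (tmul_mem_tensorDegreePart (by lia) (gen_mul_mem_degreePart x hb) hc)
      (tmul_mem_tensorDegreePart (by lia) (D.act_mem_degreePart P _ hb)
        (gen_mul_mem_degreePart x hc))

theorem isGradedHopf (h : DirectSum.IsInternal (degreePart k y)) :
    IsGradedHopf (D.hopf P) (degreePart k y) where
  isInternal := h
  act_mem _ g _ ha := D.act_mem_degreePart P g ha
  coact_mem _ _ ha := D.coact_mem_range_lTensor P ha
  mul_le i j := (pow_add _ i j).ge
  comul_mem _ _ ha := D.comul_mem_tensorDegreePart P ha

end Grading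

section Primitives

theorem gen_mem_primitives (x : X) : y x ∈ (D.hopf P).primitives :=
  (D.comul_gen P x).trans (add_comm _ _)

/-- The skew derivation `(id ⊗ f) Δ` of `R`, where `f` denotes the derivation at the augmentation
with `y_x ↦ f x`. -/
def skewDer (f : X → k) : R →ₗ[k] R :=
  (TensorProduct.rid k R).toLinearMap ∘ₗ (P.pointDerivation f).lTensor R ∘ₗ D.comul P

@[simp]
theorem skewDer_one (f : X → k) : D.skewDer P f 1 = 0 := by
  simp [skewDer]

theorem skewDer_gen_mul (f : X → k) (x : X) (a : R) :
    D.skewDer P f (y x * a) = y x * D.skewDer P f a + f x • D.act P (D.deg x) a := by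
  have h : (TensorProduct.rid k R).toLinearMap ∘ₗ (P.pointDerivation f).lTensor R ∘ₗ
        D.comulHom P (y x) =
      LinearMap.mulLeft k (y x) ∘ₗ (TensorProduct.rid k R).toLinearMap ∘ₗ
          (P.pointDerivation f).lTensor R +
        f x • (D.act P (D.deg x) ∘ₗ (TensorProduct.rid k R).toLinearMap ∘ₗ
          P.counit.toLinearMap.lTensor R) :=
    TensorProduct.ext' fun a b => by simp [smul_smul]
  have hcounit : P.counit.toLinearMap.lTensor R (D.comul P a) = a ⊗ₜ 1 :=
    LinearMap.congr_fun (D.lTensor_counit_comul P) a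
  rw [skewDer, LinearMap.comp_apply, LinearMap.comp_apply, comul_mul]
  refine (LinearMap.congr_fun h (D.comul P a)).trans ?_
  simp [hcounit]

@[simp]
theorem skewDer_gen (f : X → k) (x : X) : D.skewDer P f (y x) = f x • 1 := by
  simpa using D.skewDer_gen_mul P f x 1

theorem skewDer_of_mem_primitives (f : X → k) {a : R} (ha : a ∈ (D.hopf P).primitives) :
    D.skewDer P f a = P.pointDerivation f a • 1 := by
  have ha : D.comul P a = 1 ⊗ₜ a + a ⊗ₜ 1 := ha
  simp [skewDer, ha]

theorem counit_of_mem_primitives {a : R} (ha : a ∈ (D.hopf P).primitives) : P.counit a = 0 := by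
  have ha : D.comul P a = 1 ⊗ₜ a + a ⊗ₜ 1 := ha
  have h : P.counit.toLinearMap.lTensor R (D.comul P a) = a ⊗ₜ 1 :=
    LinearMap.congr_fun (D.lTensor_counit_comul P) a
  have h : P.counit a • (1 : R) = 0 := by
    simpa [ha] using congrArg (TensorProduct.rid k R) h
  simpa using congrArg P.counit h

/-- All `∂_x` kill the difference of a primitive element `a` and `∑ ∂_x(a) y_x`. This is a scalar,
and its counit is zero. -/
theorem primitives_eq_degreePart_one [Finite X] [DecidableEq X]
    (h : ∀ a, (∀ x, D.skewDer P (Pi.single x 1) a = 0) → a ∈ Submodule.span k {1}) :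
    (D.hopf P).primitives = degreePart k y 1 := by
  have := Fintype.ofFinite X
  rw [degreePart, pow_one]
  refine le_antisymm (fun a ha => ?_) (Submodule.span_le.2 ?_)
  · let b := ∑ x, P.pointDerivation (Pi.single x 1) a • y x
    have hb : b ∈ Submodule.span k (Set.range y) :=
      Submodule.sum_mem _ fun x _ => Submodule.smul_mem _ _ (Submodule.subset_span ⟨x, rfl⟩)
    have hker (x : X) : D.skewDer P (Pi.single x 1) (a - b) = 0 := by
      simp [b, skewDer_of_mem_primitives D P _ ha, Pi.single_apply]
    obtain ⟨c, hc⟩ := Submodule.mem_span_singleton.1 (h _ hker)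
    have hc0 : c = 0 := by
      simpa [b, counit_of_mem_primitives D P ha] using congrArg P.counit hc
    rwa [← sub_eq_zero.1 (hc.symm.trans (by rw [hc0, zero_smul]))] at hb
  · rintro _ ⟨x, rfl⟩
    exact D.gen_mem_primitives P x

end Primitives

section Inherited

theorem isInherited_of_span {V : Type*} [AddCommGroup V] [Module k V] {A : YDModule k Γ V}
    {j : V →ₗ[k] R} {v : X → V} (hv : Submodule.span k (Set.range v) = ⊤)
    (hact : ∀ g x, A.act g (v x) = D.χ g • v (g • x))
    (hdeg : ∀ x, A.toYDData.IsHomogeneous (D.deg x) (v x)) (hj : ∀ x, j (v x) = y x) :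
    (D.hopf P).IsInherited A j := by
  refine ⟨⟨fun g => LinearMap.ext_on_range hv fun x => ?_, ?_⟩, fun u => ?_⟩
  · rw [LinearMap.comp_apply, hact, map_smul, hj, LinearMap.comp_apply, hj]
    exact (D.act_gen P g x).symm
  · refine YDData.coact_comp_eq_lTensor hv hdeg fun x => ?_
    rw [hj]
    exact D.isHomogeneous_gen P x
  · suffices Submodule.span k (Set.range v) ≤ (D.hopf P).primitives.comap j from
      this (hv ▸ Submodule.mem_top)
    rw [Submodule.span_le]
    rintro _ ⟨x, rfl⟩
    rw [SetLike.mem_coe, Submodule.mem_comap, hj]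
    exact D.gen_mem_primitives P x

end Inherited

section Hom

variable {Γ' X' R' : Type*} [Group Γ'] [MulAction Γ' X'] [Ring R'] [Algebra k R'] {y' : X' → R'}

/-- Morphisms of data along a group homomorphism: they induce morphisms of the braided Hopf algebras
with `y_x ↦ y_{index x}`. -/
structure Hom (D : BraidedQuadraticDatum k Γ X) (D' : BraidedQuadraticDatum k Γ' X') where
  groupHom : Γ →* Γ'
  index : X → X'
  deg_index : ∀ x, D'.deg (index x) = groupHom (D.deg x)
  index_smul : ∀ g x, index (g • x) = groupHom g • index x
  χ_groupHom : ∀ g, D'.χ (groupHom g) = D.χ g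
  map_mem_rels : ∀ q ∈ D.rels, q.map (Prod.map index index) ∈ D'.rels

namespace Hom

variable {D} {D' : BraidedQuadraticDatum k Γ' X'} (H : D.Hom D')
  (P' : IsQuadraticPresentation k D'.rels y')

include P' in
theorem satisfiesRels_index : SatisfiesRels D.rels fun x => y' (H.index x) := fun q hq => by
  simpa [Multiset.map_map, Function.comp_def] using P'.satisfiesRels _ (H.map_mem_rels q hq)

/-- The algebra map induced by a morphism of data. -/
def algHom : R →ₐ[k] R' := P.lift _ (H.satisfiesRels_index P')

@[simp]
theorem algHom_gen (x : X) : H.algHom P P' (y x) = y' (H.index x) := P.lift_gen _ _ _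

theorem algHom_act (g : Γ) : (H.algHom P P').toLinearMap ∘ₗ D.act P g =
    D'.act P' (H.groupHom g) ∘ₗ (H.algHom P P').toLinearMap := by
  have : (H.algHom P P').comp (D.actHom P g) =
      (D'.actHom P' (H.groupHom g)).comp (H.algHom P P') :=
    P.algHom_ext fun x => by simp [H.χ_groupHom, H.index_smul]
  exact congrArg AlgHom.toLinearMap this

theorem isYDHomAlong : IsYDHomAlong H.groupHom (D.hopf P).toYDData (D'.hopf P').toYDData
    (H.algHom P P').toLinearMap := by
  refine ⟨H.algHom_act P P', YDData.coact_comp_eq_map P.span_range_prod_map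
    (D.isHomogeneous_prod_map P) (e := H.groupHom) (by simp) fun w => ?_⟩
  have hdeg : H.groupHom (w.map D.deg).prod = ((w.map H.index).map D'.deg).prod := by
    simp [map_list_prod, Function.comp_def, H.deg_index]
  have hgen : H.algHom P P' (w.map y).prod = ((w.map H.index).map y').prod := by
    simp [map_list_prod, Function.comp_def]
  rw [hdeg, AlgHom.toLinearMap_apply, hgen]
  exact D'.isHomogeneous_prod_map P' _

theorem comul_algHom : D'.comul P' ∘ₗ (H.algHom P P').toLinearMap =
    TensorProduct.map (H.algHom P P').toLinearMap (H.algHom P P').toLinearMap ∘ₗ D.comul P := by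
  have h (x : X) :
      TensorProduct.map (H.algHom P P').toLinearMap (H.algHom P P').toLinearMap ∘ₗ
          D.comulHom P (y x) =
        D'.comulHom P' (y' (H.index x)) ∘ₗ
          TensorProduct.map (H.algHom P P').toLinearMap (H.algHom P P').toLinearMap :=
    TensorProduct.ext' fun a b => by
      have hact : H.algHom P P' (D.act P (D.deg x) a) = _ :=
        LinearMap.congr_fun (H.algHom_act P P' (D.deg x)) a
      simp [hact, H.deg_index]
  refine P.linearMap_ext_of_semiconj (fun x => D'.comulHom P' (y' (H.index x))) (by simp)
    (fun x a => by simp [comul_mul]) fun x a => ?_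
  rw [LinearMap.comp_apply, comul_mul]
  exact LinearMap.congr_fun (h x) (D.comul P a)

theorem counit_algHom :
    P'.counit.toLinearMap ∘ₗ (H.algHom P P').toLinearMap = P.counit.toLinearMap := by
  have : P'.counit.comp (H.algHom P P') = P.counit := P.algHom_ext fun x => by simp
  exact congrArg AlgHom.toLinearMap this

theorem map_degreePart (hindex : Function.Surjective H.index) (d : ℕ) :
    (degreePart k y d).map (H.algHom P P').toLinearMap = degreePart k y' d := by
  have hrange : H.algHom P P' '' Set.range y = Set.range y' := by
    rw [← Set.range_comp, ← hindex.range_comp y']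
    exact congrArg Set.range (funext (H.algHom_gen P P'))
  rw [degreePart, Submodule.map_pow, Submodule.map_span]
  exact congrArg (Submodule.span k · ^ d) hrange

/-- A bijective morphism of data that reflects the relations induces an isomorphism. -/
def algEquiv (hindex : Function.Bijective H.index)
    (hrels : ∀ q, q.map (Prod.map H.index H.index) ∈ D'.rels → q ∈ D.rels) : R ≃ₐ[k] R' :=
  let e := Equiv.ofBijective H.index hindex
  have hinv : SatisfiesRels D'.rels fun x => y (e.symm x) := fun q hq => by
    have hq' : q.map (Prod.map e.symm e.symm) ∈ D.rels := hrels _ (by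
      rw [Multiset.map_map]
      convert hq
      exact (Multiset.map_congr rfl fun p _ => Prod.ext (e.apply_symm_apply p.1)
        (e.apply_symm_apply p.2)).trans (Multiset.map_id q))
    simpa [Multiset.map_map, Function.comp_def] using P.satisfiesRels _ hq'
  AlgEquiv.ofAlgHom (H.algHom P P') (P'.lift _ hinv)
    (P'.algHom_ext fun x => by
      rw [AlgHom.comp_apply, P'.lift_gen, H.algHom_gen]
      exact congrArg y' (e.apply_symm_apply x))
    (P.algHom_ext fun x => by
      rw [AlgHom.comp_apply, H.algHom_gen, P'.lift_gen]
      exact congrArg y (e.symm_apply_apply x))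

end Hom

end Hom

end BraidedQuadraticDatum

/-! ### The algebras `R¹ₙ` and `R²ₚ` -/

section Swap

open Equiv

variable {α : Type*} [DecidableEq α] {s t : Perm α}

theorem exists_eq_swap_of_not_commute (hs : s.IsSwap) (ht : t.IsSwap) (hst : ¬Commute s t) :
    ∃ x a b, x ≠ a ∧ x ≠ b ∧ s = swap x a ∧ t = swap x b := by
  obtain ⟨a, b, hab, rfl⟩ := hs
  obtain ⟨c, d, hcd, rfl⟩ := ht
  have hmeet : ¬[a, b, c, d].Nodup := fun h => hst (Perm.disjoint_swap_swap h).commute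
  have : a = c ∨ a = d ∨ b = c ∨ b = d := by grind
  rcases this with rfl | rfl | rfl | rfl
  · exact ⟨a, b, d, hab, hcd, rfl, rfl⟩
  · exact ⟨a, b, c, hab, hcd.symm, rfl, swap_comm c a⟩
  · exact ⟨b, a, d, hab.symm, hcd, swap_comm a b, rfl⟩
  · exact ⟨b, a, c, hab.symm, hcd.symm, swap_comm a b, swap_comm c b⟩

theorem mul_mul_eq_mul_mul_of_isSwap (hs : s.IsSwap) (ht : t.IsSwap) (hst : ¬Commute s t) :
    s * t * s = t * s * t := by
  obtain ⟨x, a, b, ha, hb, rfl, rfl⟩ := exists_eq_swap_of_not_commute hs ht hst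
  have hab : a ≠ b := by
    rintro rfl
    exact hst (Commute.refl _)
  rw [← swap_comm b x, swap_mul_swap_mul_swap hb.symm hab.symm, swap_comm b x, ← swap_comm a x,
    swap_mul_swap_mul_swap ha.symm hab, swap_comm]

end Swap

section SymmetricGroup

open Equiv

variable {k B : Type*} [Field k] [Ring B] {n : ℕ}

instance : MulAction (Perm (Fin n)) (Transposition n) where
  smul := Transposition.conj
  one_smul τ := Subtype.ext (by simp [HSMul.hSMul, Transposition.conj])
  mul_smul s t τ := Subtype.ext (by simp [HSMul.hSMul, Transposition.conj, mul_assoc])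

theorem Transposition.coe_smul (s : Perm (Fin n)) (τ : Transposition n) :
    (s • τ).1 = s * τ.1 * s⁻¹ := rfl

theorem Transposition.smul_eq_of_commute {s : Perm (Fin n)} {τ : Transposition n}
    (h : Commute s τ.1) : s • τ = τ :=
  Subtype.ext (by rw [coe_smul, h.eq, mul_inv_cancel_right])

theorem Transposition.smul_smul_of_not_commute {τ τ' : Transposition n}
    (h : ¬Commute τ.1 τ'.1) : τ.1 • τ'.1 • τ = τ' := by
  have hbraid := mul_mul_eq_mul_mul_of_isSwap τ.2 τ'.2 h
  refine Subtype.ext ?_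
  rw [coe_smul, coe_smul, mul_inv_eq_iff_eq_mul, ← mul_assoc, ← mul_assoc, hbraid,
    mul_inv_eq_iff_eq_mul]

variable (n) in
/-- The defining relations of `R¹ₙ`, with the redundant ones omitted: `y_τ² = 0`, and for `τ ≠ τ'`
either `y_τ y_τ' + y_τ' y_τ = 0` or, writing `τ'' = τ τ' τ⁻¹`,
`y_τ y_τ' + y_τ' y_τ'' + y_τ'' y_τ = 0`. -/
inductive transpositionRels : Set (Multiset (Transposition n × Transposition n))
  | sq (τ : Transposition n) : transpositionRels {(τ, τ)}
  | comm {τ τ' : Transposition n} (hne : τ ≠ τ') (h : Commute τ.1 τ'.1) :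
    transpositionRels {(τ, τ'), (τ', τ)}
  | braid {τ τ' : Transposition n} (h : ¬Commute τ.1 τ'.1) :
    transpositionRels {(τ, τ'), (τ', τ.1 • τ'), (τ.1 • τ', τ)}

theorem satisfiesRels_transpositionRels_iff {f : Transposition n → B} :
    SatisfiesRels (transpositionRels n) f ↔ (∀ τ, f τ * f τ = 0) ∧
      (∀ τ τ' : Transposition n, Commute τ.1 τ'.1 → f τ * f τ' + f τ' * f τ = 0) ∧
      ∀ τ τ' : Transposition n,
        f τ * f τ' + f τ' * f (τ.1 • τ') + f (τ.1 • τ') * f τ = 0 := by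
  refine ⟨fun h => ?_, fun ⟨hsq, hcomm, hbraid⟩ q hq => ?_⟩
  · have hsq (τ) : f τ * f τ = 0 := by simpa using h _ (.sq τ)
    have hcomm (τ τ' : Transposition n) (hc : Commute τ.1 τ'.1) : f τ * f τ' + f τ' * f τ = 0 := by
      rcases eq_or_ne τ τ' with rfl | hne
      · rw [hsq, add_zero]
      · simpa using h _ (.comm hne hc)
    refine ⟨hsq, hcomm, fun τ τ' => ?_⟩
    by_cases hc : Commute τ.1 τ'.1
    · rw [Transposition.smul_eq_of_commute hc, hsq, add_zero, hcomm τ τ' hc]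
    · simpa [add_assoc] using h _ (.braid hc)
  · rcases hq with τ | ⟨-, hc⟩ | @⟨τ, τ', hc⟩
    · simpa using hsq τ
    · simpa using hcomm _ _ hc
    · simpa [add_assoc] using hbraid τ τ'

theorem map_smul_mem_transpositionRels (g : Perm (Fin n))
    {q : Multiset (Transposition n × Transposition n)} (hq : q ∈ transpositionRels n) :
    q.map (g • ·) ∈ transpositionRels n := by
  have hcommute (τ τ' : Transposition n) : Commute (g • τ).1 (g • τ').1 ↔ Commute τ.1 τ'.1 :=
    Commute.conj_iff g
  rcases hq with τ | ⟨hne, h⟩ | @⟨τ, τ', h⟩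
  · exact .sq (g • τ)
  · exact .comm (by simpa using hne) ((hcommute _ _).2 h)
  · have hg : g • τ.1 • τ' = (g • τ).1 • g • τ' := by
      rw [smul_smul, smul_smul, Transposition.coe_smul, inv_mul_cancel_right]
    simp only [Multiset.insert_eq_cons, Multiset.map_cons, Multiset.map_singleton, Prod.smul_mk, hg]
    exact .braid ((hcommute _ _).not.2 h)

theorem map_braid_transpositionRels {q : Multiset (Transposition n × Transposition n)}
    (hq : q ∈ transpositionRels n) : q.map (fun p => (p.1.1 • p.2, p.1)) = q := by
  rcases hq with τ | ⟨hne, h⟩ | @⟨τ, τ', h⟩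
  · simp [Transposition.smul_eq_of_commute (Commute.refl τ.1)]
  · simp only [Multiset.insert_eq_cons, Multiset.map_cons, Multiset.map_singleton,
      Transposition.smul_eq_of_commute h, Transposition.smul_eq_of_commute h.symm]
    exact Multiset.pair_comm _ _
  · have h₁ : τ'.1 • τ.1 • τ' = τ := Transposition.smul_smul_of_not_commute fun h' => h h'.symm
    have h₂ : (τ.1 • τ').1 • τ = τ' := by
      rw [Transposition.coe_smul, ← smul_smul, ← smul_smul,
        Transposition.smul_eq_of_commute (Commute.refl τ.1).inv_left,
        Transposition.smul_smul_of_not_commute h]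
    simp only [Multiset.insert_eq_cons, Multiset.map_cons, Multiset.map_singleton, h₁, h₂]
    rw [Multiset.cons_swap, ← Multiset.insert_eq_cons (τ', _), Multiset.pair_comm,
      Multiset.insert_eq_cons]

variable (k n) in
/-- The Yetter-Drinfeld module `V` and the relations of `R¹ₙ`. -/
def transpositionDatum : BraidedQuadraticDatum k (Perm (Fin n)) (Transposition n) where
  deg := Subtype.val
  χ := ((Int.castRingHom k : ℤ →* k).comp (Units.coeHom ℤ)).comp Perm.sign
  rels := transpositionRels n
  deg_smul := Transposition.coe_smul
  χ_deg τ := by simp [τ.2.sign_eq]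
  smul_mem_rels g _ := map_smul_mem_transpositionRels g
  deg_mul_deg := by
    rintro _ (τ | ⟨hne, h⟩ | @⟨τ, τ', h⟩)
    · simp
    · exact ⟨_, by simpa using ⟨rfl, h.eq.symm⟩⟩
    · have hbraid := mul_mul_eq_mul_mul_of_isSwap τ.2 τ'.2 h
      refine ⟨τ.1 * τ'.1, ?_⟩
      simp [Transposition.coe_smul, ← mul_assoc, ← hbraid]
  map_braid _ := map_braid_transpositionRels

variable (k n) in
/-- The generator `y_τ` of `R¹ₙ`. -/
def y1 (τ : Transposition n) : R1 k n := j1 k n (Finsupp.single τ 1)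

theorem isQuadraticPresentation_y1 :
    IsQuadraticPresentation k (transpositionDatum k n).rels (y1 k n) := by
  refine .of_basis (r := Rel1 k n) Finsupp.basisSingleOne (fun τ => ?_) ?_ fun u v huv => ?_
  · rw [y1, Finsupp.coe_basisSingleOne, j1, LinearMap.comp_apply, AlgHom.toLinearMap_apply]
  · refine satisfiesRels_transpositionRels_iff.2
      ⟨fun τ => ?_, fun τ τ' h => ?_, fun τ τ' => ?_⟩
    · simpa using! RingQuot.mkAlgHom_rel k (Rel1.sq (k := k) τ)
    · simpa using! RingQuot.mkAlgHom_rel k (Rel1.comm (k := k) τ τ' h)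
    · simpa using! RingQuot.mkAlgHom_rel k (Rel1.braid (k := k) τ τ' (τ.1 • τ')
        (by rw [Transposition.coe_smul, inv_mul_cancel_right]))
  · obtain ⟨hsq, hcomm, hbraid⟩ := satisfiesRels_transpositionRels_iff.1
      (PresentedAlgebra.satisfiesRels_gen k (transpositionDatum k n).rels)
    have ht (τ : Transposition n) : TensorAlgebra.lift k (Finsupp.basisSingleOne.constr k
        (PresentedAlgebra.gen k (transpositionDatum k n).rels)) (t1 k n τ) =
        PresentedAlgebra.gen k (transpositionDatum k n).rels τ := by
      rw [t1, TensorAlgebra.lift_ι_apply, ← congrFun Finsupp.coe_basisSingleOne τ,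
        Module.Basis.constr_basis]
    rcases huv with τ | ⟨τ, τ', h⟩ | ⟨τ, τ', τ'', h⟩
    · rw [map_mul, map_zero, ht, hsq]
    · rw [map_add, map_mul, map_mul, map_zero, ht, ht, hcomm τ τ' h]
    · obtain rfl : τ'' = τ.1 • τ' := Subtype.ext (eq_mul_inv_of_mul_eq h.symm)
      simp only [map_add, map_mul, map_zero, ht, hbraid]

theorem span_range_single : Submodule.span k
    (Set.range fun τ : Transposition n => Finsupp.single τ (1 : k)) = ⊤ := by
  rw [← Finsupp.coe_basisSingleOne, Module.Basis.span_eq]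

theorem isInherited_transpositionDatum :
    ((transpositionDatum k n).hopf isQuadraticPresentation_y1).IsInherited (V1 k n) (j1 k n) := by
  refine BraidedQuadraticDatum.isInherited_of_span _ _ span_range_single (fun s τ => ?_)
    (fun τ => ?_) fun τ => rfl
  · simp only [V1, MonoidHom.coe_mk, OneHom.coe_mk, LinearMap.smul_apply,
      Finsupp.lmapDomain_apply, Finsupp.mapDomain_single]
    rfl
  · simp [V1, YDData.IsHomogeneous, transpositionDatum]

theorem grade1_eq_degreePart (d : ℕ) : grade1 k n d = degreePart k (y1 k n) d :=
  range_pow_eq_degreePart span_range_single (fun _ => rfl) d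

end SymmetricGroup

section Induced

variable {k Γ : Type*} [Field k] [Group Γ] (g : Γ) {W N : Type*} [AddCommGroup W] [Module k W]
  [AddCommGroup N] [Module k N] (ρ : Representation k (Subgroup.centralizer ({g} : Set Γ)) W)

/-- The linear map out of `M(g, ρ) = kΓ ⊗_{kΓ_g} W` with `x ⊗ w ↦ f x w`. -/
def MSpace.lift (f : Γ → W →ₗ[k] N)
    (hf : ∀ x (c : Subgroup.centralizer ({g} : Set Γ)), f (x * c) = f x ∘ₗ ρ c) :
    MSpace g ρ →ₗ[k] N :=
  Representation.Coinvariants.lift _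
    (TensorProduct.lift ((Finsupp.lift _ _ _ fun x => f x⁻¹) ∘ₗ
      (MonoidAlgebra.coeffLinearEquiv k).toLinearMap)) fun c => by
    ext x w
    have hfc : f (x⁻¹ * (c : Γ)⁻¹) = f x⁻¹ ∘ₗ ρ c⁻¹ := hf x⁻¹ c⁻¹
    simp [hfc]

@[simp]
theorem MSpace.lift_tmul (f : Γ → W →ₗ[k] N)
    (hf : ∀ x (c : Subgroup.centralizer ({g} : Set Γ)), f (x * c) = f x ∘ₗ ρ c) (x : Γ) (w : W) :
    MSpace.lift g ρ f hf (MSpace.tmul g ρ x w) = f x w := by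
  simp [MSpace.lift, MSpace.tmul]

theorem MSpace.tmul_mul (x : Γ) (c : Subgroup.centralizer ({g} : Set Γ)) (w : W) :
    MSpace.tmul g ρ (x * c) w = MSpace.tmul g ρ x (ρ c w) := by
  simpa [MSpace.tmul] using (Representation.Coinvariants.mk_self_apply (Representation.tprod
    ((Representation.leftRegular k Γ).comp (Subgroup.centralizer ({g} : Set Γ)).subtype) ρ)
    c (MonoidAlgebra.single (x * c)⁻¹ 1 ⊗ₜ w)).symm

end Induced

section Dihedral

variable {k B : Type*} [Field k] [Ring B] {p : ℕ}

/-- `D_p` acts on `ℤ/p` by `ρ i = i + 1` and `σ i = -i`. This encodes the conjugation action on the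
reflections `ρⁱ σ ρ⁻ⁱ`. -/
instance : MulAction (DihedralGroup p) (ZMod p) where
  smul
    | .r a, i => a + i
    | .sr a, i => -(a + i)
  one_smul i := zero_add i
  mul_smul := by
    rintro (a | a) (b | b) i
    · exact add_assoc a b i
    · change -(b - a + i) = a + -(b + i)
      ring
    · exact congrArg Neg.neg (add_assoc a b i)
    · change b - a + i = -(a + -(b + i))
      ring

theorem r_smul (a i : ZMod p) : DihedralGroup.r a • i = a + i := rfl

theorem sr_smul (a i : ZMod p) : DihedralGroup.sr a • i = -(a + i) := rfl

section Datum

variable [NeZero p]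

variable (p) in
/-- The defining relations of `R²ₚ`. -/
inductive dihedralRels : Set (Multiset (ZMod p × ZMod p))
  | sq (i : ZMod p) : dihedralRels {(i, i)}
  | sum (s : ZMod p) (hs : s ≠ 0) :
    dihedralRels ((Finset.univ : Finset (ZMod p)).val.map fun i => (i, i + s))

theorem satisfiesRels_dihedralRels_iff {f : ZMod p → B} :
    SatisfiesRels (dihedralRels p) f ↔
      (∀ i, f i * f i = 0) ∧ ∀ s, s ≠ 0 → ∑ i, f i * f (i + s) = 0 := by
  refine ⟨fun h => ⟨fun i => by simpa using h _ (.sq i), fun s hs => ?_⟩,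
    fun ⟨hsq, hsum⟩ q hq => ?_⟩
  · simpa [Multiset.map_map] using h _ (.sum s hs)
  · rcases hq with i | ⟨s, hs⟩
    · simpa using hsq i
    · simpa [Multiset.map_map] using hsum s hs

theorem univ_val_map_equiv {Y : Type*} (e : ZMod p ≃ ZMod p) (f : ZMod p → Y) :
    (Finset.univ : Finset (ZMod p)).val.map (fun i => f (e i)) = Finset.univ.val.map f := by
  rw [← Function.comp_def, ← Multiset.map_map, Multiset.map_univ_val_equiv]

theorem map_smul_mem_dihedralRels (g : DihedralGroup p) {q : Multiset (ZMod p × ZMod p)}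
    (hq : q ∈ dihedralRels p) : q.map (g • ·) ∈ dihedralRels p := by
  rcases hq with i | ⟨s, hs⟩
  · exact .sq (g • i)
  · rw [Multiset.map_map]
    rcases g with a | a
    · have h : Multiset.map ((DihedralGroup.r a • ·) ∘ fun i => (i, i + s)) Finset.univ.val =
          Finset.univ.val.map fun i : ZMod p => (i, i + s) :=
        Eq.trans (by simp [r_smul, add_assoc]) (univ_val_map_equiv (Equiv.addLeft a) _)
      exact h ▸ .sum s hs
    · have h : Multiset.map ((DihedralGroup.sr a • ·) ∘ fun i => (i, i + s)) Finset.univ.val =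
          Finset.univ.val.map fun i : ZMod p => (i, i + -s) :=
        Eq.trans (by simp [sr_smul, add_comm, add_left_comm])
          (univ_val_map_equiv ((Equiv.addLeft a).trans (Equiv.neg _)) _)
      exact h ▸ .sum (-s) (neg_ne_zero.2 hs)

variable (k p) in
/-- The Yetter-Drinfeld module `V = M(σ, χ)` and the relations of `R²ₚ`. -/
def dihedralDatum : BraidedQuadraticDatum k (DihedralGroup p) (ZMod p) where
  deg i := .sr (-(2 * i))
  χ := dihedralSign k p
  rels := dihedralRels p
  deg_smul := by
    rintro (a | a) i
    · simp only [r_smul, DihedralGroup.r_mul_sr, DihedralGroup.inv_r, DihedralGroup.sr_mul_r,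
        DihedralGroup.sr.injEq]
      ring
    · simp only [sr_smul, DihedralGroup.sr_mul_sr, DihedralGroup.inv_sr, DihedralGroup.r_mul_sr,
        DihedralGroup.sr.injEq]
      ring
  χ_deg _ := rfl
  smul_mem_rels g _ := map_smul_mem_dihedralRels g
  deg_mul_deg := by
    rintro _ (i | ⟨s, hs⟩)
    · simp
    · refine ⟨.r (-(2 * s)), fun q hq => ?_⟩
      obtain ⟨i, -, rfl⟩ := Multiset.mem_map.1 hq
      rw [DihedralGroup.sr_mul_sr]
      congr 1
      ring
  map_braid := by
    rintro _ (i | ⟨s, hs⟩)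
    · simp [sr_smul, two_mul]
    · rw [Multiset.map_map]
      refine Eq.trans (Multiset.map_congr rfl fun i _ => ?_)
        (univ_val_map_equiv (Equiv.subRight s) _)
      have hsr : -(-(2 * i) + (i + s)) = i - s := by ring
      simp only [Function.comp_apply, sr_smul, hsr, Equiv.subRight_apply, sub_add_cancel]

end Datum

section Basis

theorem v2_eq_tmul (i : ZMod p) : v2 k p i = MSpace.tmul (sigma p) (chi k p) (.r i) 1 :=
  (MSpace.act_tmul _ _ _ _ _).trans (by rw [mul_one])

theorem tmul_r (i : ZMod p) (w : k) :
    MSpace.tmul (sigma p) (chi k p) (.r i) w = w • v2 k p i := by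
  rw [v2_eq_tmul, MSpace.tmul, MSpace.tmul, ← map_smul, smul_eq_mul, mul_one]

theorem tmul_sr (i : ZMod p) (w : k) :
    MSpace.tmul (sigma p) (chi k p) (.sr i) w = -w • v2 k p (-i) := by
  let c : Subgroup.centralizer ({sigma p} : Set (DihedralGroup p)) :=
    ⟨sigma p, Subgroup.mem_centralizer_singleton_iff.2 rfl⟩
  have hc : chi k p c w = -w := neg_one_mul w
  rw [← tmul_r, ← hc, ← MSpace.tmul_mul]
  simp [c]

theorem act_v2 (g : DihedralGroup p) (i : ZMod p) :
    (V2 k p).act g (v2 k p i) = dihedralSign k p g • v2 k p (g • i) := by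
  rw [v2_eq_tmul]
  refine (MSpace.act_tmul _ _ _ _ _).trans ?_
  rcases g with a | a
  · exact tmul_r (a + i) 1
  · exact tmul_sr (a + i) 1

theorem isHomogeneous_v2 (i : ZMod p) :
    (V2 k p).toYDData.IsHomogeneous (.sr (-(2 * i))) (v2 k p i) := by
  have hdeg : DihedralGroup.r i * sigma p * (DihedralGroup.r i)⁻¹ = .sr (-(2 * i)) := by
    simp [two_mul, sub_eq_add_neg]
  rw [v2_eq_tmul, ← hdeg]
  exact MSpace.coact_tmul (sigma p) (chi k p) (.r i) 1

theorem span_range_v2 : Submodule.span k (Set.range (v2 k p)) = ⊤ := by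
  rw [← Submodule.ker_mkQ (Submodule.span k (Set.range (v2 k p))), LinearMap.ker_eq_top]
  refine MSpace.hom_ext _ _ fun x w => ?_
  rw [Submodule.mkQ_apply, LinearMap.zero_apply, Submodule.Quotient.mk_eq_zero]
  rcases x with i | i
  · rw [tmul_r]
    exact Submodule.smul_mem _ _ (Submodule.subset_span ⟨i, rfl⟩)
  · rw [tmul_sr]
    exact Submodule.smul_mem _ _ (Submodule.subset_span ⟨-i, rfl⟩)

theorem smul_zero_of_mem_centralizer_sigma (hp : Odd p) {c : DihedralGroup p}
    (hc : c ∈ Subgroup.centralizer {sigma p}) : c • (0 : ZMod p) = 0 := by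
  rw [Subgroup.mem_centralizer_singleton_iff] at hc
  obtain ⟨a, rfl | rfl, ha⟩ : ∃ a, (c = .r a ∨ c = .sr a) ∧ a + a = 0 := by
    rcases c with a | a
    · exact ⟨a, .inl rfl, by simpa [neg_eq_iff_add_eq_zero, eq_neg_iff_add_eq_zero] using hc⟩
    · exact ⟨a, .inr rfl, by simpa [neg_eq_iff_add_eq_zero, eq_neg_iff_add_eq_zero] using hc⟩
  · rw [r_smul, add_zero, (ZMod.add_self_eq_zero_iff_eq_zero hp).1 ha]
  · rw [sr_smul, add_zero, (ZMod.add_self_eq_zero_iff_eq_zero hp).1 ha, neg_zero]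

theorem exists_linearMap_v2_eq_single (hp : Odd p) :
    ∃ F : MSpace (sigma p) (chi k p) →ₗ[k] ZMod p →₀ k, ∀ i, F (v2 k p i) = .single i 1 := by
  refine ⟨MSpace.lift _ _ (fun x => dihedralSign k p x • Finsupp.lsingle (x • 0)) ?_, fun i => ?_⟩
  · rintro x ⟨c, hc⟩
    ext
    simp [mul_smul, smul_zero_of_mem_centralizer_sigma hp hc, chi]
  · rw [v2_eq_tmul, MSpace.lift_tmul]
    have hχ : dihedralSign k p (.r i) = 1 := rfl
    simp [r_smul, hχ]

variable (k) in
/-- The basis of the elements `y_i` of `V = M(σ, χ)`. -/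
def v2Basis (hp : Odd p) : Module.Basis (ZMod p) k (MSpace (sigma p) (chi k p)) :=
  .mk (v := v2 k p)
    (by
      obtain ⟨F, hF⟩ := exists_linearMap_v2_eq_single (k := k) hp
      refine LinearIndependent.of_comp F ?_
      rw [show F ∘ v2 k p = fun i => Finsupp.single i 1 from funext hF]
      exact Finsupp.linearIndependent_single_one k _)
    span_range_v2.ge

theorem v2Basis_apply (hp : Odd p) (i : ZMod p) : v2Basis k hp i = v2 k p i :=
  Module.Basis.mk_apply _ _ i

end Basis

section Presentation

variable [NeZero p]

theorem isQuadraticPresentation_y (hp : Odd p) :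
    IsQuadraticPresentation k (dihedralDatum k p).rels (y k p) := by
  refine .of_basis (r := Rel2 k p) (v2Basis k hp) (fun i => ?_) ?_ fun u v huv => ?_
  · rw [v2Basis_apply, y, j2, LinearMap.comp_apply, AlgHom.toLinearMap_apply]
  · refine satisfiesRels_dihedralRels_iff.2 ⟨fun i => ?_, fun s hs => ?_⟩
    · simpa using! RingQuot.mkAlgHom_rel k (Rel2.sq (k := k) i)
    · simpa using! RingQuot.mkAlgHom_rel k (Rel2.sum (k := k) s hs)
  · obtain ⟨hsq, hsum⟩ := satisfiesRels_dihedralRels_iff.1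
      (PresentedAlgebra.satisfiesRels_gen k (dihedralDatum k p).rels)
    have ht (i : ZMod p) : TensorAlgebra.lift k ((v2Basis k hp).constr k
        (PresentedAlgebra.gen k (dihedralDatum k p).rels)) (t2 k p i) =
        PresentedAlgebra.gen k (dihedralDatum k p).rels i := by
      rw [t2, TensorAlgebra.lift_ι_apply, ← v2Basis_apply hp, Module.Basis.constr_basis]
    rcases huv with i | ⟨s, hs⟩
    · rw [map_mul, map_zero, ht, hsq]
    · simp only [map_sum, map_mul, map_zero, ht, hsum s hs]

theorem isInherited_dihedralDatum (hp : Odd p) :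
    ((dihedralDatum k p).hopf (isQuadraticPresentation_y hp)).IsInherited (V2 k p) (j2 k p) :=
  BraidedQuadraticDatum.isInherited_of_span _ _ span_range_v2 act_v2 isHomogeneous_v2 fun _ => rfl

theorem grade2_eq_degreePart (d : ℕ) : grade2 k p d = degreePart k (y k p) d :=
  range_pow_eq_degreePart span_range_v2 (fun _ => rfl) d

end Presentation

end Dihedral

/-! ### The monomial basis of `R²₃` -/

section WordPairing

variable {X Γ : Type*} [DecidableEq X] [Group Γ] [MulAction Γ X]

/-- The value of the skew derivation `∂_i` on a word in the generators, as a list of words with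
coefficients: a letter `x = i` is removed at the cost of acting by `deg x` on the letters to its
right. -/
def wordDer (deg : X → Γ) (i : X) : List X → List (ℤ × List X)
  | [] => []
  | x :: v => (wordDer deg i v).map (Prod.map id (x :: ·)) ++
      if x = i then [((-1) ^ v.length, v.map (deg x • ·))] else []

/-- The constant term of `∂_j ⋯ ∂_i v` for a word `[i, …, j]`. -/
def wordPairing (deg : X → Γ) : List X → List X → ℤ
  | [], [] => 1
  | [], _ :: _ => 0
  | i :: w, v => ((wordDer deg i v).map fun p => p.1 * wordPairing deg w p.2).sum

namespace BraidedQuadraticDatum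

variable {k R : Type*} [Field k] [Ring R] [Algebra k R] {y : X → R}
  (D : BraidedQuadraticDatum k Γ X) (P : IsQuadraticPresentation k D.rels y)

theorem skewDer_prod_map (i : X) (v : List X) : D.skewDer P (Pi.single i 1) (v.map y).prod =
    ((wordDer D.deg i v).map fun p => (p.1 : k) • (p.2.map y).prod).sum := by
  induction v with
  | nil => simp [wordDer]
  | cons x v ih =>
    have hmul : y x * ((wordDer D.deg i v).map fun p => (p.1 : k) • (p.2.map y).prod).sum =
        (((wordDer D.deg i v).map (Prod.map id (x :: ·))).map
          fun p => (p.1 : k) • (p.2.map y).prod).sum := by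
      simp [← List.sum_map_mul_left, Function.comp_def]
    rw [List.map_cons, List.prod_cons, skewDer_gen_mul, ih, hmul, act_prod_map, χ_deg, wordDer,
      List.map_append, List.sum_append, Pi.single_apply]
    split_ifs <;> simp

/-- The functional `ε ∂_j ⋯ ∂_i` for a word `[i, …, j]`. -/
def wordFunctional : List X → R →ₗ[k] k
  | [] => P.counit.toLinearMap
  | i :: w => wordFunctional w ∘ₗ D.skewDer P (Pi.single i 1)

theorem wordFunctional_prod_map (w v : List X) :
    D.wordFunctional P w (v.map y).prod = wordPairing D.deg w v := by
  induction w generalizing v with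
  | nil => cases v <;> simp [wordFunctional, wordPairing]
  | cons i w ih =>
    simp [wordFunctional, wordPairing, skewDer_prod_map, map_list_sum, Function.comp_def, ih]

end BraidedQuadraticDatum

end WordPairing

section WordBasis

variable {k X R ι : Type*} [Field k] [Ring R] [Algebra k R] {y : X → R} {m : ι → R} {deg : ι → ℕ}

theorem prod_map_mem_degreePart (w : List X) : (w.map y).prod ∈ degreePart k y w.length := by
  induction w with
  | nil => exact one_mem_degreePart_zero
  | cons x w ih => exact gen_mul_mem_degreePart x ih

theorem degreePart_eq_span_image (hm : ∀ j, m j ∈ degreePart k y (deg j))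
    (h1 : 1 ∈ Submodule.span k (m '' {i | deg i = 0}))
    (hmul : ∀ x j, y x * m j ∈ Submodule.span k (m '' {i | deg i = deg j + 1})) (d : ℕ) :
    degreePart k y d = Submodule.span k (m '' {i | deg i = d}) := by
  refine le_antisymm
    (degreePart_le (N := fun d => Submodule.span k (m '' {i | deg i = d})) h1
      (fun d x a ha => ?_) d)
    (Submodule.span_le.2 ?_)
  · suffices Submodule.span k (m '' {i | deg i = d}) ≤
        (Submodule.span k (m '' {i | deg i = d + 1})).comap (LinearMap.mulLeft k (y x)) from this ha
    rw [Submodule.span_le]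
    rintro _ ⟨j, rfl, rfl⟩
    exact hmul x j
  · rintro _ ⟨j, rfl, rfl⟩
    exact hm j

theorem isInternal_span_image (b : Module.Basis ι k R) (deg : ι → ℕ) :
    DirectSum.IsInternal fun d => Submodule.span k (b '' {i | deg i = d}) := by
  apply DirectSum.isInternal_submodule_of_iSupIndep_of_iSup_eq_top
  · intro d
    refine Disjoint.mono_right (iSup₂_le fun e he => ?_)
      (b.linearIndependent.disjoint_span_image (s := {i | deg i = d}) (t := {i | deg i ≠ d}) ?_)
    · exact Submodule.span_mono (Set.image_mono fun i hi hd => he (hi.symm.trans hd))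
    · exact Set.disjoint_left.2 fun i hi hi' => hi' hi
  · rw [eq_top_iff, ← b.span_eq, Submodule.span_le]
    rintro _ ⟨j, rfl⟩
    exact Submodule.mem_iSup_of_mem (deg j) (Submodule.subset_span ⟨j, rfl, rfl⟩)

theorem finrank_span_image (hm : LinearIndependent k m) (s : Set ι) [Fintype s] :
    Module.finrank k (Submodule.span k (m '' s)) = Fintype.card s := by
  rw [Set.image_eq_range]
  exact finrank_span_eq_card (hm.comp _ Subtype.val_injective)

end WordBasis

section FominKirillovRelations

variable {R : Type*} [Ring R] {y : ZMod 3 → R} {i j l : ZMod 3}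
  (hy : SatisfiesRels (dihedralRels 3) y)

include hy

theorem fk_mul_self (i : ZMod 3) : y i * y i = 0 :=
  (satisfiesRels_dihedralRels_iff.1 hy).1 i

theorem fk_mul_self_mul (i : ZMod 3) (a : R) : y i * (y i * a) = 0 := by
  rw [← mul_assoc, fk_mul_self hy, zero_mul]

theorem fk_cyclic_sum (hij : i ≠ j) (hjl : j ≠ l) (hil : i ≠ l) :
    y i * y j + y j * y l + y l * y i = 0 := by
  have huniv : ∀ i j l : ZMod 3, i ≠ j → j ≠ l → i ≠ l → Finset.univ = {i, j, l} := by decide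
  have hshift : ∀ i j l : ZMod 3, i ≠ j → j ≠ l → i ≠ l →
      j + (j - i) = l ∧ l + (j - i) = i := by decide
  have h := (satisfiesRels_dihedralRels_iff.1 hy).2 (j - i) (sub_ne_zero.2 hij.symm)
  obtain ⟨hl, hi⟩ := hshift i j l hij hjl hil
  rw [huniv i j l hij hjl hil, Finset.sum_insert (by simp [hij, hil]), Finset.sum_pair hjl,
    add_sub_cancel, hl, hi, ← add_assoc] at h
  exact h

theorem fk_mul (hij : i ≠ j) (hjl : j ≠ l) (hil : i ≠ l) :
    y l * y i = -(y i * y j) - y j * y l := by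
  rw [← add_right_inj (y i * y j + y j * y l), fk_cyclic_sum hy hij hjl hil]
  abel

theorem fk_mul_mul_self (hij : i ≠ j) (hjl : j ≠ l) (hil : i ≠ l) :
    y i * (y l * y i) = -(y i * (y j * y l)) := by
  rw [fk_mul hy hij hjl hil, mul_sub, mul_neg, fk_mul_self_mul hy, neg_zero, zero_sub]

theorem fk_braid (hij : i ≠ j) (hjl : j ≠ l) (hil : i ≠ l) :
    y i * (y j * y i) = y j * (y i * y j) := by
  rw [fk_mul_mul_self hy hil hjl.symm hij, ← mul_assoc, ← mul_assoc, neg_eq_iff_add_eq_zero]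
  have h := congrArg (· * y j) (fk_cyclic_sum hy hil hjl.symm hij)
  simpa only [add_mul, zero_mul, mul_assoc, fk_mul_self hy, mul_zero, add_zero] using h

theorem fk_reverse (hij : i ≠ j) (hjl : j ≠ l) (hil : i ≠ l) :
    y i * (y j * y l) = y l * (y j * y i) := by
  rw [← neg_inj, ← fk_mul_mul_self hy hij hjl hil, ← fk_mul_mul_self hy hjl.symm hij.symm hil.symm,
    fk_braid hy hil hjl.symm hij]

theorem fk_two_mul_zero_mul_one : y 2 * (y 0 * y 1) = y 1 * (y 0 * y 2) :=
  fk_reverse hy (by decide) (by decide) (by decide)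

theorem fk_two_mul_one_mul_zero : y 2 * (y 1 * y 0) = y 0 * (y 1 * y 2) :=
  fk_reverse hy (by decide) (by decide) (by decide)

theorem fk_one_mul_zero_mul_one : y 1 * (y 0 * y 1) = y 0 * (y 1 * y 0) :=
  fk_braid hy (l := 2) (by decide) (by decide) (by decide)

theorem fk_zero_mul_two_mul_zero : y 0 * (y 2 * y 0) = -(y 0 * (y 1 * y 2)) :=
  fk_mul_mul_self hy (by decide) (by decide) (by decide)

theorem fk_two_mul_zero_mul_two : y 2 * (y 0 * y 2) = -(y 0 * (y 1 * y 2)) := by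
  rw [fk_mul_mul_self hy (j := 1) (by decide) (by decide) (by decide), fk_two_mul_one_mul_zero hy]

theorem fk_two_mul_one_mul_two : y 2 * (y 1 * y 2) = -(y 1 * (y 0 * y 2)) := by
  rw [fk_mul_mul_self hy (j := 0) (by decide) (by decide) (by decide), fk_two_mul_zero_mul_one hy]

end FominKirillovRelations

section FominKirillovBasis

/-- The words whose monomials form the basis of the algebra `R²₃`, which is also known as the
Fomin-Kirillov algebra of `S₃`. -/
def fkWord : Fin 12 → List (ZMod 3) :=
  ![[], [0], [1], [2], [0, 1], [1, 2], [0, 2], [1, 0], [0, 1, 0], [0, 1, 2], [1, 0, 2],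
    [0, 1, 0, 2]]

/-- The words `w` for which the functionals `D.wordFunctional P w` form, up to sign, the dual basis
of the monomials `fkWord`. -/
def fkDualWord : Fin 12 → List (ZMod 3) :=
  ![[], [0], [1], [2], [0, 2], [2, 1], [2, 0], [1, 2], [0, 1, 0], [2, 1, 0], [2, 0, 1],
    [2, 0, 1, 0]]

/-- The signs that normalize the functionals given by `fkDualWord`. -/
def fkDualSign : Fin 12 → ℤ := ![1, 1, 1, 1, -1, 1, 1, -1, 1, 1, 1, 1]

theorem fkDualSign_mul_wordPairing : ∀ i j : Fin 12,
    fkDualSign i * wordPairing (fun i : ZMod 3 => DihedralGroup.sr (-(2 * i)))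
      (fkDualWord i) (fkWord j) = if i = j then 1 else 0 := by
  decide

variable {k R : Type*} [Field k] [Ring R] [Algebra k R] {y : ZMod 3 → R}

theorem gen_mul_prod_fkWord_mem (hy : SatisfiesRels (dihedralRels 3) y) (x : ZMod 3) (j : Fin 12) :
    y x * ((fkWord j).map y).prod ∈ Submodule.span k
      ((fun i => ((fkWord i).map y).prod) '' {i | (fkWord i).length = (fkWord j).length + 1}) := by
  set N : ℕ → Submodule k R := fun d =>
    Submodule.span k ((fun i => ((fkWord i).map y).prod) '' {i | (fkWord i).length = d})
  have hN (i : Fin 12) : ((fkWord i).map y).prod ∈ N (fkWord i).length :=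
    Submodule.subset_span ⟨i, rfl, rfl⟩
  change _ ∈ N _
  obtain ⟨-, h0, h1, h2, h01, h12, h02, h10, h010, h012, h102, h0102⟩ :
      1 ∈ N 0 ∧ y 0 ∈ N 1 ∧ y 1 ∈ N 1 ∧ y 2 ∈ N 1 ∧ y 0 * y 1 ∈ N 2 ∧ y 1 * y 2 ∈ N 2 ∧
        y 0 * y 2 ∈ N 2 ∧ y 1 * y 0 ∈ N 2 ∧ y 0 * (y 1 * y 0) ∈ N 3 ∧ y 0 * (y 1 * y 2) ∈ N 3 ∧
        y 1 * (y 0 * y 2) ∈ N 3 ∧ y 0 * (y 1 * (y 0 * y 2)) ∈ N 4 := by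
    simpa [fkWord, Fin.forall_fin_succ] using hN
  have h20 : y 2 * y 0 ∈ N 2 := by
    rw [fk_mul hy (j := 1) (by decide) (by decide) (by decide)]
    exact sub_mem (neg_mem h01) h12
  have h21 : y 2 * y 1 ∈ N 2 := by
    rw [fk_mul hy (j := 0) (by decide) (by decide) (by decide)]
    exact sub_mem (neg_mem h10) h02
  have hassoc {a b c a' b' c' : R} (h : a * (b * c) = a' * (b' * c')) (d : R) :
      a * (b * (c * d)) = a' * (b' * (c' * d)) := by
    simpa only [mul_assoc] using congrArg (· * d) h
  obtain rfl | rfl | rfl : x = 0 ∨ x = 1 ∨ x = 2 := by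
    revert x
    decide
  all_goals fin_cases j <;>
    simp [fkWord, neg_mem_iff, h0, h1, h2, h01, h12, h02, h10, h20, h21, h010, h012, h102, h0102,
      fk_mul_self hy, fk_mul_self_mul hy, fk_two_mul_zero_mul_one hy, fk_two_mul_one_mul_zero hy,
      fk_one_mul_zero_mul_one hy, fk_zero_mul_two_mul_zero hy, fk_two_mul_zero_mul_two hy,
      fk_two_mul_one_mul_two hy, hassoc (fk_two_mul_zero_mul_one hy),
      hassoc (fk_two_mul_one_mul_zero hy), hassoc (fk_one_mul_zero_mul_one hy)]

theorem degreePart_eq_span_fkWord (hy : SatisfiesRels (dihedralRels 3) y) (d : ℕ) :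
    degreePart k y d =
      Submodule.span k ((fun i => ((fkWord i).map y).prod) '' {i | (fkWord i).length = d}) :=
  degreePart_eq_span_image (fun _ => prod_map_mem_degreePart _)
    (Submodule.subset_span ⟨0, rfl, rfl⟩) (gen_mul_prod_fkWord_mem hy) d

variable (P : IsQuadraticPresentation k (dihedralDatum k 3).rels y)

theorem wordFunctional_fkDualWord (i j : Fin 12) :
    (fkDualSign i : k) * (dihedralDatum k 3).wordFunctional P (fkDualWord i)
      ((fkWord j).map y).prod = if i = j then 1 else 0 := by
  rw [BraidedQuadraticDatum.wordFunctional_prod_map]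
  exact_mod_cast congrArg (Int.cast : ℤ → k) (fkDualSign_mul_wordPairing i j)

include P in
theorem linearIndependent_fkWord : LinearIndependent k fun i => ((fkWord i).map y).prod := by
  rw [Fintype.linearIndependent_iff]
  intro c hc i
  have h := congrArg (fun a => (fkDualSign i : k) *
    (dihedralDatum k 3).wordFunctional P (fkDualWord i) a) hc
  simpa [Finset.mul_sum, mul_left_comm _ (c _), wordFunctional_fkDualWord] using h

include P in
theorem span_range_fkWord : Submodule.span k (Set.range fun i => ((fkWord i).map y).prod) = ⊤ := by
  rw [eq_top_iff, ← P.span_range_prod_map, Submodule.span_le]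
  rintro _ ⟨w, rfl⟩
  have h := prod_map_mem_degreePart (k := k) (y := y) w
  rw [degreePart_eq_span_fkWord P.satisfiesRels] at h
  exact Submodule.span_mono (Set.image_subset_range _ _) h

/-- The basis of the algebra `R²₃` that consists of the monomials `fkWord`. -/
def fkBasis : Module.Basis (Fin 12) k R :=
  .mk (linearIndependent_fkWord P) (span_range_fkWord P).ge

theorem coe_fkBasis : ⇑(fkBasis P) = fun i => ((fkWord i).map y).prod := Module.Basis.coe_mk _ _

theorem fkBasis_repr (a : R) (i : Fin 12) : (fkBasis P).repr a i =
    fkDualSign i * (dihedralDatum k 3).wordFunctional P (fkDualWord i) a := by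
  have h : (fkBasis P).coord i =
      (fkDualSign i : k) • (dihedralDatum k 3).wordFunctional P (fkDualWord i) := by
    refine (fkBasis P).ext fun j => ?_
    rw [Module.Basis.coord_apply, Module.Basis.repr_self, LinearMap.smul_apply, coe_fkBasis,
      smul_eq_mul, wordFunctional_fkDualWord, Finsupp.single_apply]
    simp only [eq_comm]
  exact LinearMap.congr_fun h a

include P in
theorem finrank_degreePart (d : ℕ) :
    Module.finrank k (degreePart k y d) = Fintype.card {i // (fkWord i).length = d} := by
  rw [degreePart_eq_span_fkWord P.satisfiesRels]
  exact finrank_span_image (linearIndependent_fkWord P) _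

include P in
theorem degreePart_eq_bot {d : ℕ} (hd : 5 ≤ d) : degreePart k y d = ⊥ := by
  have hlt : ∀ i, (fkWord i).length < 5 := by decide
  rw [degreePart_eq_span_fkWord P.satisfiesRels, Submodule.span_eq_bot]
  rintro _ ⟨i, rfl, rfl⟩
  exact absurd (hlt i) hd.not_gt

include P in
theorem isInternal_degreePart : DirectSum.IsInternal (degreePart k y) := by
  have h : degreePart k y =
      fun d => Submodule.span k (fkBasis P '' {i | (fkWord i).length = d}) := by
    funext d
    rw [coe_fkBasis, degreePart_eq_span_fkWord P.satisfiesRels]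
  rw [h]
  exact isInternal_span_image (fkBasis P) _

theorem mem_span_one_of_skewDer_eq_zero {a : R}
    (ha : ∀ x, (dihedralDatum k 3).skewDer P (Pi.single x 1) a = 0) :
    a ∈ Submodule.span k {1} := by
  have hne : ∀ i, i ≠ 0 → fkDualWord i ≠ [] := by decide
  have hrepr (i : Fin 12) (hi : i ≠ 0) : (fkBasis P).repr a i = 0 := by
    obtain ⟨x, w, hw⟩ := List.exists_cons_of_ne_nil (hne i hi)
    rw [fkBasis_repr, hw, BraidedQuadraticDatum.wordFunctional, LinearMap.comp_apply, ha, map_zero,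
      mul_zero]
  rw [← (fkBasis P).sum_repr a, Finset.sum_eq_single 0 (fun i _ hi => by simp [hrepr i hi])
    (by simp), coe_fkBasis]
  exact Submodule.smul_mem _ _ (Submodule.mem_span_singleton_self _)

theorem isTOBA_hopf : IsTOBA ((dihedralDatum k 3).hopf P) (degreePart k y) where
  toIsGradedHopf := (dihedralDatum k 3).isGradedHopf P (isInternal_degreePart P)
  zero_equiv := by
    have := Module.Finite.of_basis (fkBasis P)
    refine ⟨LinearEquiv.ofFinrankEq _ _ ?_⟩
    rw [finrank_degreePart P, Module.finrank_self]
    rfl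
  sq_eq := iSup_pow_sq _
  primitives_eq := (dihedralDatum k 3).primitives_eq_degreePart_one P
    fun _ => mem_span_one_of_skewDer_eq_zero P

end FominKirillovBasis

/-! ### The isomorphism of `R²₃` and `R¹₃` -/

section Isomorphism

open Equiv

/-- The isomorphism `D₃ ≃ S₃` given by the action of `D₃` on `ℤ/3`. -/
def dihedralEquivPerm : DihedralGroup 3 ≃* Perm (Fin 3) :=
  MulEquiv.ofBijective (MulAction.toPermHom (DihedralGroup 3) (ZMod 3)) (by decide)

theorem sign_dihedralEquivPerm_r : ∀ a : ZMod 3, Perm.sign (dihedralEquivPerm (.r a)) = 1 := by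
  decide

theorem isSwap_dihedralEquivPerm_sr : ∀ a : ZMod 3, (dihedralEquivPerm (.sr a)).IsSwap := by
  simp only [Perm.IsSwap]
  decide

theorem sign_dihedralEquivPerm (k : Type*) [Field k] (g : DihedralGroup 3) :
    ((Perm.sign (dihedralEquivPerm g) : ℤ) : k) = dihedralSign k 3 g := by
  rcases g with a | a
  · rw [sign_dihedralEquivPerm_r, Units.val_one, Int.cast_one]
    rfl
  · rw [(isSwap_dihedralEquivPerm_sr a).sign_eq, Units.val_neg, Units.val_one, Int.cast_neg,
      Int.cast_one]
    rfl

/-- The transposition that fixes `i`. -/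
def transpositionFixing (i : ZMod 3) : Transposition 3 :=
  ⟨dihedralEquivPerm (.sr (-(2 * i))), isSwap_dihedralEquivPerm_sr _⟩

theorem transpositionFixing_bijective : Function.Bijective transpositionFixing := by
  refine ⟨fun i j h => ?_, fun τ => ?_⟩
  · have hinj : ∀ i j : ZMod 3, DihedralGroup.sr (-(2 * i)) = .sr (-(2 * j)) → i = j := by decide
    exact hinj i j (dihedralEquivPerm.injective (congrArg Subtype.val h))
  · obtain ⟨g, hg⟩ := dihedralEquivPerm.surjective τ.1
    rcases g with a | a
    · have h := τ.2.sign_eq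
      rw [← hg, sign_dihedralEquivPerm_r] at h
      exact absurd h (by decide)
    · have ha : ∀ a : ZMod 3, -(2 * a) = a := by decide
      exact ⟨a, Subtype.ext (by simp only [transpositionFixing, ha, hg])⟩

theorem transpositionFixing_smul (g : DihedralGroup 3) (i : ZMod 3) :
    transpositionFixing (g • i) = dihedralEquivPerm g • transpositionFixing i := by
  have h : ∀ (g : DihedralGroup 3) (i : ZMod 3),
      DihedralGroup.sr (-(2 * (g • i))) = g * .sr (-(2 * i)) * g⁻¹ := by decide
  refine Subtype.ext ?_
  simp only [Transposition.coe_smul, transpositionFixing, h, map_mul, map_inv]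

theorem commute_transpositionFixing_iff {i j : ZMod 3} :
    Commute (transpositionFixing i).1 (transpositionFixing j).1 ↔ i = j := by
  have h : ∀ i j : ZMod 3,
      Commute (DihedralGroup.sr (-(2 * i))) (.sr (-(2 * j))) → i = j := by
    simp only [Commute, SemiconjBy]
    decide
  refine ⟨fun hc => h i j ?_, fun hij => hij ▸ Commute.refl _⟩
  exact Commute.of_map dihedralEquivPerm.injective hc

theorem univ_val_map_eq_braid : ∀ i j : ZMod 3, i ≠ j →
    (Finset.univ : Finset (ZMod 3)).val.map (fun l => (l, l + (j - i))) =
      {(i, j), (j, DihedralGroup.sr (-(2 * i)) • j),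
        (DihedralGroup.sr (-(2 * i)) • j, i)} := by
  decide

theorem map_transpositionFixing_braid (i j : ZMod 3) :
    ({(i, j), (j, DihedralGroup.sr (-(2 * i)) • j), (DihedralGroup.sr (-(2 * i)) • j, i)} :
      Multiset (ZMod 3 × ZMod 3)).map (Prod.map transpositionFixing transpositionFixing) =
      {(transpositionFixing i, transpositionFixing j),
        (transpositionFixing j, (transpositionFixing i).1 • transpositionFixing j),
        ((transpositionFixing i).1 • transpositionFixing j, transpositionFixing i)} := by
  simp only [Multiset.insert_eq_cons, Multiset.map_cons, Multiset.map_singleton, Prod.map_apply,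
    transpositionFixing_smul]
  rfl

theorem map_transpositionFixing_mem_iff {q : Multiset (ZMod 3 × ZMod 3)} :
    q.map (Prod.map transpositionFixing transpositionFixing) ∈ transpositionRels 3 ↔
      q ∈ dihedralRels 3 := by
  have hinj := Multiset.map_injective
    (transpositionFixing_bijective.injective.prodMap transpositionFixing_bijective.injective)
  refine ⟨fun h => ?_, fun h => ?_⟩
  · generalize hr : q.map _ = r at h
    rcases h with τ | @⟨τ, τ', hne, hc⟩ | @⟨τ, τ', hc⟩ <;>
      obtain ⟨i, rfl⟩ := transpositionFixing_bijective.surjective τ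
    · rw [hinj (hr.trans (Multiset.map_singleton (Prod.map _ _) (i, i)).symm)]
      exact .sq i
    · obtain ⟨j, rfl⟩ := transpositionFixing_bijective.surjective τ'
      exact absurd (congrArg _ (commute_transpositionFixing_iff.1 hc)) hne
    · obtain ⟨j, rfl⟩ := transpositionFixing_bijective.surjective τ'
      have hij : i ≠ j := fun hij => hc (commute_transpositionFixing_iff.2 hij)
      rw [hinj (hr.trans (map_transpositionFixing_braid i j).symm),
        ← univ_val_map_eq_braid i j hij]
      exact .sum _ (sub_ne_zero.2 hij.symm)
  · rcases h with i | ⟨s, hs⟩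
    · exact .sq _
    · have h := univ_val_map_eq_braid 0 s hs.symm
      rw [sub_zero] at h
      rw [h, map_transpositionFixing_braid]
      exact .braid fun hc => hs (commute_transpositionFixing_iff.1 hc).symm

variable (k : Type*) [Field k]

/-- The isomorphism of `V = M(σ, χ)` and `V'` along `D₃ ≃ S₃`, and of their relations. -/
def dihedralHomTransposition : (dihedralDatum k 3).Hom (transpositionDatum k 3) where
  groupHom := dihedralEquivPerm
  index := transpositionFixing
  deg_index _ := rfl
  index_smul := transpositionFixing_smul
  χ_groupHom := sign_dihedralEquivPerm k
  map_mem_rels _ := map_transpositionFixing_mem_iff.2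

end Isomorphism

end YetterDrinfeld

end

open YetterDrinfeld in
theorem mainTheorem2 (k : Type*) [Field k] :
    ∃ (T₁ : YDHopfAlgebra k (Equiv.Perm (Fin 3)) (R1 k 3))
      (T₂ : YDHopfAlgebra k (DihedralGroup 3) (R2 k 3)),
      T₁.IsInherited (V1 k 3) (j1 k 3) ∧
      T₂.IsInherited (V2 k 3) (j2 k 3) ∧
      -- `R²₃` and `R¹₃` are isomorphic as graded braided Hopf algebras, along `D₃ ≃ S₃`
      (∃ (φ : DihedralGroup 3 ≃* Equiv.Perm (Fin 3)) (F : R2 k 3 ≃ₐ[k] R1 k 3),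
        IsYDHomAlong φ.toMonoidHom T₂.toYDData T₁.toYDData F.toLinearMap ∧
        T₁.comul ∘ₗ F.toLinearMap = TensorProduct.map F.toLinearMap F.toLinearMap ∘ₗ T₂.comul ∧
        T₁.counit ∘ₗ F.toLinearMap = T₂.counit ∧
        ∀ d, (grade2 k 3 d).map F.toLinearMap = grade1 k 3 d) ∧
      -- `R²₃` is a TOBA of dimension 12
      IsTOBA T₂ (grade2 k 3) ∧
      Module.finrank k (R2 k 3) = 12 ∧
      -- the Hilbert series is `1 + 3t + 4t² + 3t³ + t⁴`
      Module.finrank k (grade2 k 3 0) = 1 ∧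
      Module.finrank k (grade2 k 3 1) = 3 ∧
      Module.finrank k (grade2 k 3 2) = 4 ∧
      Module.finrank k (grade2 k 3 3) = 3 ∧
      Module.finrank k (grade2 k 3 4) = 1 ∧
      (∀ d, 5 ≤ d → grade2 k 3 d = ⊥) ∧
      -- the explicit basis
      ∃ b : Module.Basis (Fin 12) k (R2 k 3),
        ⇑b = ![1, y k 3 0, y k 3 1, y k 3 2,
          y k 3 0 * y k 3 1, y k 3 1 * y k 3 2, y k 3 0 * y k 3 2, y k 3 1 * y k 3 0,
          y k 3 0 * y k 3 1 * y k 3 0, y k 3 0 * y k 3 1 * y k 3 2, y k 3 1 * y k 3 0 * y k 3 2,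
          y k 3 0 * y k 3 1 * y k 3 0 * y k 3 2] := by
  have hp : Odd 3 := by decide
  have P₁ := isQuadraticPresentation_y1 (k := k) (n := 3)
  have P₂ := isQuadraticPresentation_y (k := k) hp
  let H := dihedralHomTransposition k
  have hH : Function.Bijective H.index := transpositionFixing_bijective
  rw [show grade1 k 3 = degreePart k (y1 k 3) from funext grade1_eq_degreePart,
    show grade2 k 3 = degreePart k (y k 3) from funext grade2_eq_degreePart]
  exact ⟨(transpositionDatum k 3).hopf P₁, (dihedralDatum k 3).hopf P₂,
    isInherited_transpositionDatum, isInherited_dihedralDatum hp,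
    ⟨dihedralEquivPerm, H.algEquiv P₂ P₁ hH fun _ => map_transpositionFixing_mem_iff.1,
      H.isYDHomAlong P₂ P₁, H.comul_algHom P₂ P₁, H.counit_algHom P₂ P₁,
      H.map_degreePart P₂ P₁ hH.surjective⟩,
    isTOBA_hopf P₂, Module.finrank_eq_card_basis (fkBasis P₂), finrank_degreePart P₂ 0,
    finrank_degreePart P₂ 1, finrank_degreePart P₂ 2, finrank_degreePart P₂ 3,
    finrank_degreePart P₂ 4, fun _ => degreePart_eq_bot P₂, fkBasis P₂, by
      simp [coe_fkBasis, fkWord, funext_iff, Fin.forall_fin_succ, mul_assoc]⟩
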